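/- Let $X$ be an infinite compact metric space, let $\alpha : X \to X$ be a homeomorphism, and let $\mathscr{V}$ be a complex vector bundle of finite (locally constant, not necessarily constant) rank over $X$, equipped with a Hermitian structure, all of whose fibres are non-zero. Let $\Gamma(\mathscr{V},\alpha)$ be the $\mathrm{C}^*$-correspondence over $C(X)$ whose underlying right Hilbert $C(X)$-module is the module $\Gamma(\mathscr{V})$ of continuous sections of $\mathscr{V}$, with $(\xi f)(x) = f(x)\,\xi(x)$ and $\langle \xi,\eta\rangle(x) = \langle \xi(x),\eta(x)\rangle_{\mathscr{V}_x}$, and whose structure map is $\varphi(f)\xi = \xi\,(f\circ\alpha)$ for $f\in C(X)$ and $\xi\in\Gamma(\mathscr{V})$. Let $\mathcal{O}(\Gamma(\mathscr{V},\alpha))$ be its Cuntz--Pimsner algebra, that is, the $\mathrm{C}^*$-algebra generated by the universal covariant representation of $\Gamma(\mathscr{V},\alpha)$ in the sense of Katsura. Then $\mathcal{O}(\Gamma(\mathscr{V},\alpha))$ is simple (it is non-zero and its only closed two-sided ideals are $0$ and itself) if and only if $\alpha$ is minimal, i.e. the only closed subsets $E\subseteq X$ with $\alpha(E)\subseteq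 E$ are $\emptyset$ and $X$. -/

import Mathlib

open Topology
open scoped ENNReal InnerProductSpace ComplexOrder

universe u v

set_option linter.unusedSectionVars false

noncomputable section

/-! ### C⋆-correspondences over a commutative unital C⋆-algebra

A right Hilbert `A`-module is a complete `E` with Mathlib's `CStarModule A E`.  As `A` is
commutative, the right action `ξ a` is written `a • ξ`; the inner product is conjugate linear in
the first variable and linear in the second. -/

section Correspondence

variable {A : Type u} {E : Type v} [CommCStarAlgebra A] [PartialOrder A] [StarOrderedRing A]
  [NormedAddCommGroup E] [NormedSpace ℂ E] [CompleteSpace E] [Module A E] [CStarModule A E]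

theorem CStarModule.norm_smul_le' (a : A) (ξ : E) : ‖a • ξ‖ ≤ ‖a‖ * ‖ξ‖ := by
  have h1 : ‖a • ξ‖ ^ 2 ≤ (‖a‖ * ‖ξ‖) ^ 2 := by
    rw [CStarModule.norm_sq_eq A, CStarModule.inner_op_smul_right,
      CStarModule.inner_op_smul_left]
    calc ‖a * (⟪ξ, ξ⟫_A * star a)‖ ≤ ‖a‖ * (‖⟪ξ, ξ⟫_A‖ * ‖star a‖) :=
          (norm_mul_le _ _).trans (by gcongr; exact norm_mul_le _ _)
      _ = (‖a‖ * ‖ξ‖) ^ 2 := by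
          rw [norm_star, mul_pow, CStarModule.norm_sq_eq A (x := ξ)]; ring
  exact (pow_le_pow_iff_left₀ (norm_nonneg _) (by positivity) (by simp)).mp h1

variable (A) in
/-- The rank one operator `θ_{ξ,η}`, `ζ ↦ ξ ⟨η, ζ⟩`. -/
def CStarModule.rankOne (ξ η : E) : E →L[ℂ] E :=
  LinearMap.mkContinuous
    { toFun := fun ζ => ⟪η, ζ⟫_A • ξ
      map_add' := fun x y => by rw [CStarModule.inner_add_right, add_smul]
      map_smul' := fun z x => by
        have key : ∀ (z : ℂ) (a : A), (z • a) • ξ = z • (a • ξ) := fun z a => by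
          rw [← sub_eq_zero, ← CStarModule.inner_self (A := A)]
          simp only [CStarModule.inner_sub_left, CStarModule.inner_sub_right,
            CStarModule.inner_op_smul_right, CStarModule.inner_op_smul_left,
            CStarModule.inner_smul_right_complex, CStarModule.inner_smul_left_complex]
          simp
        rw [CStarModule.inner_smul_right_complex, key, RingHom.id_apply] }
    (‖η‖ * ‖ξ‖) fun ζ => by
      calc ‖⟪η, ζ⟫_A • ξ‖ ≤ ‖⟪η, ζ⟫_A‖ * ‖ξ‖ := CStarModule.norm_smul_le' _ _
        _ ≤ (‖η‖ * ‖ζ‖) * ‖ξ‖ := by gcongr; exact CStarModule.norm_inner_le E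
        _ = ‖η‖ * ‖ξ‖ * ‖ζ‖ := by ring

variable (A E) in
/-- The compact operators `𝓚(E)`: the closed linear span of the rank one operators. -/
def CStarModule.compacts : Submodule ℂ (E →L[ℂ] E) :=
  (Submodule.span ℂ {T | ∃ ξ η : E, T = CStarModule.rankOne A ξ η}).topologicalClosure

theorem CStarModule.rankOne_mem (ξ η : E) :
    CStarModule.rankOne A ξ η ∈ CStarModule.compacts A E :=
  Submodule.le_topologicalClosure _ (Submodule.subset_span ⟨ξ, η, rfl⟩)

variable (A E) in
/-- A C⋆-correspondence over `A` with underlying right Hilbert module `E`: a structure map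
`φ : A → 𝓛(E)` into the adjointable operators which is a ⋆-homomorphism, i.e. it is an algebra
homomorphism and `φ (a⋆)` is the adjoint of `φ a`. -/
structure CStarCorrespondence where
  φ : A →ₙₐ[ℂ] (E →L[ℂ] E)
  adjoint : ∀ (a : A) (ξ η : E), ⟪φ a ξ, η⟫_A = ⟪ξ, φ (star a) η⟫_A

namespace CStarCorrespondence

variable (C : CStarCorrespondence A E)

/-- Katsura's ideal `J = φ⁻¹(𝓚(E)) ∩ (ker φ)^⊥`, as a set. -/
def katsuraIdeal : Set A :=
  {a | C.φ a ∈ CStarModule.compacts A E ∧ ∀ b, C.φ b = 0 → a * b = 0}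

/-- A representation of the correspondence on a C⋆-algebra `B`. -/
structure Representation (B : Type*) [NonUnitalCStarAlgebra B] where
  π : A →⋆ₙₐ[ℂ] B
  τ : E →ₗ[ℂ] B
  map_inner : ∀ ξ η : E, π ⟪ξ, η⟫_A = star (τ ξ) * τ η
  map_left : ∀ (a : A) (ξ : E), π a * τ ξ = τ (C.φ a ξ)

/-- Covariance: `π a = ψ (φ a)` for `a` in Katsura's ideal, where `ψ : 𝓚(E) → B` is the
(unique) continuous linear map with `ψ θ_{ξ,η} = τ(ξ) τ(η)⋆`. -/
def Representation.IsCovariant {C : CStarCorrespondence A E} {B : Type*}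
    [NonUnitalCStarAlgebra B] (ρ : C.Representation B) : Prop :=
  ∃ ψ : CStarModule.compacts A E →L[ℂ] B,
    (∀ ξ η : E, ψ ⟨CStarModule.rankOne A ξ η, CStarModule.rankOne_mem ξ η⟩ =
      ρ.τ ξ * star (ρ.τ η)) ∧
    ∀ (a : A) (ha : a ∈ C.katsuraIdeal), ρ.π a = ψ ⟨C.φ a, ha.1⟩

/-- A covariant representation together with its target. The C⋆-algebra generated by any
representation has a generating set indexed by `A` and `E`, hence is isomorphic to one which lives
in the universe of `A` and `E`; so no representation is lost by the choice of universe. -/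
structure CovariantRep where
  B : Type (max u v)
  [instB : NonUnitalCStarAlgebra B]
  rep : C.Representation B
  covariant : rep.IsCovariant

attribute [instance] CovariantRep.instB

/-- The C⋆-algebra of bounded families in the targets of all covariant representations. -/
abbrev RepProduct : Type (max u v + 1) := lp (fun ρ : C.CovariantRep => ρ.B) ∞

theorem Representation.norm_τ_le {C : CStarCorrespondence A E} {B : Type*}
    [NonUnitalCStarAlgebra B] (ρ : C.Representation B) (ξ : E) : ‖ρ.τ ξ‖ ≤ ‖ξ‖ := by
  have h : ‖ρ.τ ξ‖ ^ 2 ≤ ‖ξ‖ ^ 2 := by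
    rw [pow_two, ← CStarRing.norm_star_mul_self, ← ρ.map_inner, CStarModule.norm_sq_eq A]
    exact NonUnitalStarAlgHom.norm_apply_le ρ.π _
  exact (pow_le_pow_iff_left₀ (norm_nonneg _) (norm_nonneg _) (by simp)).mp h

/-- The direct sum `(π_ρ a)_ρ` over all covariant representations `ρ`. -/
def univπ (a : A) : C.RepProduct :=
  ⟨fun ρ => ρ.rep.π a, memℓp_infty ⟨‖a‖, by
    rintro _ ⟨ρ, rfl⟩; exact NonUnitalStarAlgHom.norm_apply_le ρ.rep.π a⟩⟩

/-- The direct sum `(τ_ρ ξ)_ρ` over all covariant representations `ρ`. -/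
def univτ (ξ : E) : C.RepProduct :=
  ⟨fun ρ => ρ.rep.τ ξ, memℓp_infty ⟨‖ξ‖, by
    rintro _ ⟨ρ, rfl⟩; exact ρ.rep.norm_τ_le ξ⟩⟩

/-- The C⋆-algebra generated by the universal covariant representation, as a closed
⋆-subalgebra. -/
def cuntzPimsnerSubalgebra : NonUnitalStarSubalgebra ℂ C.RepProduct :=
  (NonUnitalStarAlgebra.adjoin ℂ (Set.range C.univπ ∪ Set.range C.univτ)).topologicalClosure

instance : IsClosed (C.cuntzPimsnerSubalgebra : Set C.RepProduct) :=
  NonUnitalStarSubalgebra.isClosed_topologicalClosure _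

/-- The Cuntz–Pimsner algebra `𝓞(E)`. -/
abbrev CuntzPimsner : Type (max u v + 1) := C.cuntzPimsnerSubalgebra

instance : NonUnitalCStarAlgebra C.CuntzPimsner :=
  NonUnitalStarSubalgebra.nonUnitalCStarAlgebra _

end CStarCorrespondence

end Correspondence

/-- A C⋆-algebra is simple if it is nonzero and has no closed two-sided ideals besides `0` and
itself. -/
def IsSimpleCStarAlgebra (B : Type*) [NonUnitalCStarAlgebra B] : Prop :=
  Nontrivial B ∧ ∀ I : TwoSidedIdeal B, IsClosed (I : Set B) → I = ⊥ ∨ I = ⊤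

/-! ### Hermitian vector bundles and their sections -/

/-- A complex vector bundle of finite rank over `X` (the rank may vary from point to point, it is
locally constant) with a Hermitian structure, i.e. inner products on the fibres which depend
continuously on the base point.  By polarization the latter amounts to the continuity of
`v ↦ ‖v‖` on the total space. -/
structure HermitianVectorBundle (X : Type u) [TopologicalSpace X] where
  Fiber : X → Type v
  [normedAddCommGroup : ∀ x, NormedAddCommGroup (Fiber x)]
  [innerProductSpace : ∀ x, InnerProductSpace ℂ (Fiber x)]
  [topology : TopologicalSpace (Bundle.TotalSpace Unit Fiber)]
  locally_trivial : ∀ x, ∃ (n : ℕ) (e : Bundle.Trivialization (EuclideanSpace ℂ (Fin n))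
    (Bundle.TotalSpace.proj : Bundle.TotalSpace Unit Fiber → X)),
      x ∈ e.baseSet ∧ ∀ y ∈ e.baseSet, IsLinearMap ℂ fun v : Fiber y => (e ⟨y, v⟩).2
  continuous_norm : Continuous fun v : Bundle.TotalSpace Unit Fiber => ‖v.snd‖

namespace HermitianVectorBundle

variable {X : Type u} [TopologicalSpace X]

/-- The total space. -/
abbrev Total (V : HermitianVectorBundle.{u, v} X) : Type (max u v) :=
  Bundle.TotalSpace Unit V.Fiber

instance (V : HermitianVectorBundle.{u, v} X) (x : X) : NormedAddCommGroup (V.Fiber x) :=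
  V.normedAddCommGroup x

instance (V : HermitianVectorBundle.{u, v} X) (x : X) : InnerProductSpace ℂ (V.Fiber x) :=
  V.innerProductSpace x

instance (V : HermitianVectorBundle.{u, v} X) : TopologicalSpace V.Total := V.topology

/-- The module `Γ(V)` of continuous sections. -/
@[ext]
structure Section (V : HermitianVectorBundle.{u, v} X) : Type (max u v) where
  toFun : ∀ x, V.Fiber x
  continuous_toFun : Continuous fun x => (⟨x, toFun x⟩ : V.Total)

variable {V : HermitianVectorBundle.{u, v} X}

instance : CoeFun V.Section fun _ => ∀ x, V.Fiber x := ⟨Section.toFun⟩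

theorem continuousAt_mk_iff {n : ℕ} {e : Bundle.Trivialization (EuclideanSpace ℂ (Fin n))
    (Bundle.TotalSpace.proj : V.Total → X)} {x : X} (hx : x ∈ e.baseSet) (s : ∀ x, V.Fiber x) :
    ContinuousAt (fun y => (⟨y, s y⟩ : V.Total)) x ↔
      ContinuousAt (fun y => (e ⟨y, s y⟩).2) x := by
  have := e.tendsto_nhds_iff (l := 𝓝 x) (f := fun y => (⟨y, s y⟩ : V.Total))
    (z := ⟨x, s x⟩) (e.mem_source.2 hx)
  rw [ContinuousAt, this]
  exact and_iff_right Filter.tendsto_id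

theorem continuous_add' {s t : ∀ x, V.Fiber x}
    (hs : Continuous fun x => (⟨x, s x⟩ : V.Total))
    (ht : Continuous fun x => (⟨x, t x⟩ : V.Total)) :
    Continuous fun x => (⟨x, s x + t x⟩ : V.Total) := by
  rw [continuous_iff_continuousAt]
  intro x
  obtain ⟨n, e, hx, he⟩ := V.locally_trivial x
  rw [continuousAt_mk_iff hx]
  refine (((continuousAt_mk_iff hx s).1 hs.continuousAt).add
    ((continuousAt_mk_iff hx t).1 ht.continuousAt)).congr ?_
  filter_upwards [e.open_baseSet.mem_nhds hx] with y hy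
  exact ((he y hy).map_add _ _).symm

theorem continuous_smul' {f : X → ℂ} (hf : Continuous f) {s : ∀ x, V.Fiber x}
    (hs : Continuous fun x => (⟨x, s x⟩ : V.Total)) :
    Continuous fun x => (⟨x, f x • s x⟩ : V.Total) := by
  rw [continuous_iff_continuousAt]
  intro x
  obtain ⟨n, e, hx, he⟩ := V.locally_trivial x
  rw [continuousAt_mk_iff hx]
  refine (hf.continuousAt.smul ((continuousAt_mk_iff hx s).1 hs.continuousAt)).congr ?_
  filter_upwards [e.open_baseSet.mem_nhds hx] with y hy
  exact ((he y hy).map_smul _ _).symm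

variable (V) in
theorem continuous_zero' : Continuous fun x => (⟨x, 0⟩ : V.Total) := by
  rw [continuous_iff_continuousAt]
  intro x
  obtain ⟨n, e, hx, he⟩ := V.locally_trivial x
  rw [continuousAt_mk_iff hx]
  refine (continuousAt_const (y := (0 : EuclideanSpace ℂ (Fin n)))).congr ?_
  filter_upwards [e.open_baseSet.mem_nhds hx] with y hy
  exact (he y hy).map_zero.symm

theorem continuous_neg' {s : ∀ x, V.Fiber x} (hs : Continuous fun x => (⟨x, s x⟩ : V.Total)) :
    Continuous fun x => (⟨x, -s x⟩ : V.Total) := by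
  simpa using continuous_smul' (f := fun _ => (-1 : ℂ)) continuous_const hs

theorem continuous_inner' {s t : ∀ x, V.Fiber x}
    (hs : Continuous fun x => (⟨x, s x⟩ : V.Total))
    (ht : Continuous fun x => (⟨x, t x⟩ : V.Total)) :
    Continuous fun x => inner ℂ (s x) (t x) := by
  have hn : ∀ z : ℂ, Continuous fun x => ((‖s x + z • t x‖ : ℝ) : ℂ) := fun z =>
    Complex.continuous_ofReal.comp (V.continuous_norm.comp
      (continuous_add' hs (continuous_smul' continuous_const ht)))
  have h1 := hn 1
  have h2 := hn (-1)
  have h3 := hn (-Complex.I)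
  have h4 := hn Complex.I
  simp only [one_smul, neg_smul, ← sub_eq_add_neg] at h1 h2 h3 h4
  simp only [inner_eq_sum_norm_sq_div_four (𝕜 := ℂ)]
  exact ((((h1.pow 2).sub (h2.pow 2)).add (((h3.pow 2).sub (h4.pow 2)).mul
    continuous_const)).div_const 4)

namespace Section

instance : Zero V.Section := ⟨⟨fun _ => 0, continuous_zero' V⟩⟩
instance : Add V.Section :=
  ⟨fun s t => ⟨fun x => s x + t x, continuous_add' s.continuous_toFun t.continuous_toFun⟩⟩
instance : Neg V.Section := ⟨fun s => ⟨fun x => -s x, continuous_neg' s.continuous_toFun⟩⟩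
/-- The action of `C(X)` by pointwise multiplication. -/
instance : SMul C(X, ℂ) V.Section :=
  ⟨fun f s => ⟨fun x => f x • s x, continuous_smul' f.continuous s.continuous_toFun⟩⟩
instance : SMul ℂ V.Section :=
  ⟨fun z s => ⟨fun x => z • s x, continuous_smul' continuous_const s.continuous_toFun⟩⟩

@[simp] theorem zero_apply (x : X) : (0 : V.Section) x = 0 := rfl
@[simp] theorem add_apply (s t : V.Section) (x : X) : (s + t) x = s x + t x := rfl
@[simp] theorem neg_apply (s : V.Section) (x : X) : (-s) x = -s x := rfl
@[simp] theorem smul_apply (f : C(X, ℂ)) (s : V.Section) (x : X) : (f • s) x = f x • s x := rfl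
@[simp] theorem smul_apply' (z : ℂ) (s : V.Section) (x : X) : (z • s) x = z • s x := rfl

instance : AddCommGroup V.Section where
  add_assoc s t r := by ext x; simp [add_assoc]
  zero_add s := by ext x; simp
  add_zero s := by ext x; simp
  add_comm s t := by ext x; simp [add_comm]
  neg_add_cancel s := by ext x; simp
  nsmul := nsmulRec
  zsmul := zsmulRec

instance : Module C(X, ℂ) V.Section where
  one_smul s := by ext x; simp
  mul_smul f g s := by ext x; simp [mul_smul]
  smul_zero f := by ext x; simp
  smul_add f s t := by ext x; simp
  add_smul f g s := by ext x; simp [add_smul]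
  zero_smul s := by ext x; simp

instance : Module ℂ V.Section where
  one_smul s := by ext x; simp
  mul_smul f g s := by ext x; simp [mul_smul]
  smul_zero f := by ext x; simp
  smul_add f s t := by ext x; simp
  add_smul f g s := by ext x; simp [add_smul]
  zero_smul s := by ext x; simp

/-- The `C(X)`-valued inner product `⟨ξ, η⟩(x) = ⟨ξ(x), η(x)⟩`. -/
instance : Inner C(X, ℂ) V.Section :=
  ⟨fun s t => ⟨fun x => inner ℂ (s x) (t x),
    continuous_inner' s.continuous_toFun t.continuous_toFun⟩⟩

@[simp] theorem inner_apply (s t : V.Section) (x : X) :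
    ⟪s, t⟫_(C(X, ℂ)) x = inner ℂ (s x) (t x) := rfl

variable [CompactSpace X]

instance : Norm V.Section := CStarModule.norm C(X, ℂ)

instance : CStarModule C(X, ℂ) V.Section where
  inner_add_right := by intros; ext x; simp
  inner_self_nonneg := fun {s} => by
    rw [ContinuousMap.le_def]
    intro x
    rw [inner_apply, ContinuousMap.zero_apply, inner_self_eq_norm_sq_to_K]
    simp only [Complex.coe_algebraMap, ← Complex.ofReal_pow]
    exact Complex.zero_le_real.2 (sq_nonneg ‖s x‖)
  inner_self := fun {s} => by
    refine ⟨fun h => ?_, fun h => by subst h; ext x; simp⟩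
    ext x
    have := DFunLike.congr_fun h x
    simpa using this
  inner_op_smul_right := by intros; ext x; simp
  inner_smul_right_complex := by intros; ext x; simp
  star_inner s t := by ext x; simp
  norm_eq_sqrt_norm_inner_self _ := rfl

instance : NormedAddCommGroup V.Section := CStarModule.normedAddCommGroup C(X, ℂ)

instance : NormedSpace ℂ V.Section := .ofCore (CStarModule.normedSpaceCore C(X, ℂ))

theorem norm_apply_le (s : V.Section) (x : X) : ‖s x‖ ≤ ‖s‖ := by
  refine (pow_le_pow_iff_left₀ (norm_nonneg _) (norm_nonneg _) two_ne_zero).mp ?_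
  rw [CStarModule.norm_sq_eq C(X, ℂ) (x := s)]
  refine le_trans (le_of_eq ?_) (ContinuousMap.norm_coe_le_norm ⟪s, s⟫_(C(X, ℂ)) x)
  rw [inner_apply, inner_self_eq_norm_sq_to_K]
  simp

theorem norm_le_of_forall {s : V.Section} {c : ℝ} (hc : 0 ≤ c) (h : ∀ x, ‖s x‖ ≤ c) :
    ‖s‖ ≤ c := by
  refine (pow_le_pow_iff_left₀ (norm_nonneg _) hc two_ne_zero).mp ?_
  rw [CStarModule.norm_sq_eq C(X, ℂ) (x := s), ContinuousMap.norm_le _ (by positivity)]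
  intro x
  rw [inner_apply, inner_self_eq_norm_sq_to_K]
  simpa using pow_le_pow_left₀ (norm_nonneg _) (h x) 2

end Section

/-- Near each point the coordinates in a chart are bounded by the norm. -/
theorem exists_chart_bound {n : ℕ} {e : Bundle.Trivialization (EuclideanSpace ℂ (Fin n))
    (Bundle.TotalSpace.proj : V.Total → X)}
    (he : ∀ y ∈ e.baseSet, IsLinearMap ℂ fun v : V.Fiber y => (e ⟨y, v⟩).2)
    {x : X} (hx : x ∈ e.baseSet) :
    ∃ c : ℝ, 0 < c ∧ ∀ᶠ y in 𝓝 x, ∀ v : V.Fiber y, c * ‖(e ⟨y, v⟩).2‖ ≤ ‖v‖ := by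
  classical
  let g : X × EuclideanSpace ℂ (Fin n) → ℝ := fun p => ‖(e.toOpenPartialHomeomorph.symm p).snd‖
  have hg : ContinuousOn g e.target :=
    V.continuous_norm.comp_continuousOn e.toOpenPartialHomeomorph.symm.continuousOn
  have hsub : ({x} : Set X) ×ˢ Metric.sphere (0 : EuclideanSpace ℂ (Fin n)) 1 ⊆ e.target := by
    rintro ⟨y, w⟩ ⟨rfl, -⟩
    exact e.mem_target.2 hx
  have hK : IsCompact (({x} : Set X) ×ˢ Metric.sphere (0 : EuclideanSpace ℂ (Fin n)) 1) :=
    isCompact_singleton.prod (isCompact_sphere _ _)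
  have hpos : ∀ p ∈ ({x} : Set X) ×ˢ Metric.sphere (0 : EuclideanSpace ℂ (Fin n)) 1, 0 < g p := by
    rintro ⟨y, w⟩ ⟨rfl, hw⟩
    have hw0 : w ≠ 0 := by
      rintro rfl
      simp at hw
    refine norm_pos_iff.2 fun h0 => hw0 ?_
    have h1 := e.apply_symm_apply' (x := w) hx
    have h2 : (e.toOpenPartialHomeomorph.symm (y, w)).proj = y := e.proj_symm_apply' hx
    generalize e.toOpenPartialHomeomorph.symm (y, w) = z at h0 h1 h2
    obtain ⟨y', v⟩ := z
    obtain rfl : y' = y := h2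
    obtain rfl : v = 0 := h0
    have h3 := (he y' hx).map_zero
    simp only [h1] at h3
    exact h3
  obtain ⟨c, hc, hcK⟩ := hK.exists_forall_le' (hg.mono hsub) hpos
  have hopen : IsOpen (e.target ∩ g ⁻¹' Set.Ioi (c / 2)) :=
    hg.isOpen_inter_preimage e.open_target isOpen_Ioi
  obtain ⟨a, b, ha, -, hxa, hb, hab⟩ := generalized_tube_lemma isCompact_singleton
    (isCompact_sphere (0 : EuclideanSpace ℂ (Fin n)) 1) hopen
    (fun p hp => ⟨hsub hp, lt_of_lt_of_le (half_lt_self hc) (hcK p hp)⟩)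
  refine ⟨c / 2, half_pos hc, ?_⟩
  filter_upwards [ha.mem_nhds (hxa rfl), e.open_baseSet.mem_nhds hx] with y hya hye v
  by_cases hw : (e ⟨y, v⟩).2 = 0
  · simp [hw]
  have hwn : 0 < ‖(e ⟨y, v⟩).2‖ := norm_pos_iff.2 hw
  set r : ℝ := ‖(e ⟨y, v⟩).2‖ with hr
  have hlin : (e ⟨y, ((r⁻¹ : ℝ) : ℂ) • v⟩).2 = ((r⁻¹ : ℝ) : ℂ) • (e ⟨y, v⟩).2 :=
    (he y hye).map_smul _ _
  have hsph : (e ⟨y, ((r⁻¹ : ℝ) : ℂ) • v⟩).2 ∈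
      Metric.sphere (0 : EuclideanSpace ℂ (Fin n)) 1 := by
    rw [hlin, mem_sphere_zero_iff_norm, norm_smul, Complex.norm_real, ← hr, Real.norm_eq_abs,
      abs_of_pos (inv_pos.2 hwn), inv_mul_cancel₀ hwn.ne']
  have hlt : c / 2 < g (y, (e ⟨y, ((r⁻¹ : ℝ) : ℂ) • v⟩).2) :=
    (hab (Set.mk_mem_prod hya (hb hsph))).2
  have hsymm := e.symm_apply_mk_proj
    (x := (⟨y, ((r⁻¹ : ℝ) : ℂ) • v⟩ : V.Total)) (e.mem_source.2 hye)
  have hgv : g (y, (e ⟨y, ((r⁻¹ : ℝ) : ℂ) • v⟩).2) = r⁻¹ * ‖v‖ := by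
    change ‖(e.toOpenPartialHomeomorph.symm (y, (e ⟨y, ((r⁻¹ : ℝ) : ℂ) • v⟩).2)).snd‖ = _
    change e.toOpenPartialHomeomorph.symm (y, (e ⟨y, ((r⁻¹ : ℝ) : ℂ) • v⟩).2) = _ at hsymm
    rw [hsymm]
    change ‖((r⁻¹ : ℝ) : ℂ) • v‖ = _
    rw [norm_smul, Complex.norm_real, Real.norm_eq_abs, abs_of_pos (inv_pos.2 hwn)]
  rw [hgv, inv_mul_eq_div, lt_div_iff₀ hwn] at hlt
  exact hlt.le

instance [CompactSpace X] : CompleteSpace V.Section := by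
  refine Metric.complete_of_cauchySeq_tendsto fun u hu => ?_
  have hcomp : ∀ x, CompleteSpace (V.Fiber x) := fun x => by
    obtain ⟨n, e, hx, he⟩ := V.locally_trivial x
    have hinj : Function.Injective (he x hx).mk' := fun v w hvw => by
      have h : e ⟨x, v⟩ = e ⟨x, w⟩ := by
        refine Prod.ext ?_ hvw
        rw [e.coe_fst' (x := (⟨x, v⟩ : V.Total)) hx, e.coe_fst' (x := (⟨x, w⟩ : V.Total)) hx]
      have h2 := e.toOpenPartialHomeomorph.injOn
        (e.mem_source.2 hx : (⟨x, v⟩ : V.Total) ∈ e.source)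
        (e.mem_source.2 hx : (⟨x, w⟩ : V.Total) ∈ e.source) h
      simpa using h2
    have := Module.Finite.of_injective _ hinj
    exact FiniteDimensional.complete ℂ (V.Fiber x)
  have hux : ∀ x, ∃ l, Filter.Tendsto (fun n => u n x) Filter.atTop (𝓝 l) := fun x => by
    refine cauchySeq_tendsto_of_complete (Metric.cauchySeq_iff.2 fun ε hε => ?_)
    obtain ⟨N, hN⟩ := Metric.cauchySeq_iff.1 hu ε hε
    refine ⟨N, fun m hm n hn => lt_of_le_of_lt ?_ (hN m hm n hn)⟩
    rw [dist_eq_norm, dist_eq_norm]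
    simpa [sub_eq_add_neg] using Section.norm_apply_le (u m - u n) x
  choose s hs using hux
  have hunif : ∀ ε > 0, ∃ N, ∀ n ≥ N, ∀ x, ‖u n x - s x‖ ≤ ε := fun ε hε => by
    obtain ⟨N, hN⟩ := Metric.cauchySeq_iff.1 hu ε hε
    refine ⟨N, fun n hn x => ?_⟩
    refine le_of_tendsto ((tendsto_const_nhds.sub (hs x)).norm) ?_
    filter_upwards [Filter.eventually_ge_atTop N] with m hm
    have h := hN n hn m hm
    rw [dist_eq_norm] at h
    refine le_trans ?_ h.le
    simpa [sub_eq_add_neg] using Section.norm_apply_le (u n - u m) x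
  have hcont : Continuous fun x => (⟨x, s x⟩ : V.Total) := by
    rw [continuous_iff_continuousAt]
    intro x
    obtain ⟨n, e, hx, he⟩ := V.locally_trivial x
    rw [continuousAt_mk_iff hx]
    obtain ⟨c, hc, hev⟩ := exists_chart_bound he hx
    refine continuousAt_of_locally_uniform_approx_of_continuousAt fun U hU => ?_
    obtain ⟨ε, hε, hεU⟩ := Metric.mem_uniformity_dist.1 hU
    obtain ⟨N, hN⟩ := hunif (c * (ε / 2)) (by positivity)
    refine ⟨_, Filter.inter_mem hev (e.open_baseSet.mem_nhds hx),
      fun y => (e ⟨y, u N y⟩).2,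
      (continuousAt_mk_iff hx _).1 (u N).continuous_toFun.continuousAt, ?_⟩
    rintro y ⟨hy1, hy2⟩
    refine hεU ?_
    have h1 : (e ⟨y, u N y - s y⟩).2 = (e ⟨y, u N y⟩).2 - (e ⟨y, s y⟩).2 :=
      (he y hy2).map_sub _ _
    have h2 := (hy1 (u N y - s y)).trans (hN N le_rfl y)
    rw [h1] at h2
    rw [dist_comm, dist_eq_norm]
    linarith [le_of_mul_le_mul_left h2 hc]
  refine ⟨⟨s, hcont⟩, Metric.tendsto_atTop.2 fun ε hε => ?_⟩
  obtain ⟨N, hN⟩ := hunif (ε / 2) (half_pos hε)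
  refine ⟨N, fun n hn => ?_⟩
  rw [dist_eq_norm]
  refine lt_of_le_of_lt (Section.norm_le_of_forall (half_pos hε).le fun x => ?_)
    (half_lt_self hε)
  simpa [sub_eq_add_neg] using hN n hn x

variable [CompactSpace X]

/-- The C⋆-correspondence `Γ(V, α)` over `C(X)`: the right Hilbert module `Γ(V)` with structure
map `φ(f) ξ = ξ (f ∘ α)`. -/
def sectionCorrespondence (V : HermitianVectorBundle.{u, v} X) (α : X ≃ₜ X) :
    CStarCorrespondence C(X, ℂ) V.Section where
  φ :=
    { toFun := fun f => LinearMap.mkContinuous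
        { toFun := fun ξ => f.comp (α : C(X, X)) • ξ
          map_add' := fun ξ η => smul_add _ _ _
          map_smul' := fun z ξ => by ext x; simp [smul_comm z] }
        ‖f.comp (α : C(X, X))‖ fun ξ => CStarModule.norm_smul_le' _ ξ
      map_smul' := fun z f => by ext ξ x; simp [mul_smul]
      map_zero' := by ext ξ x; simp
      map_add' := fun f g => by ext ξ x; simp [add_smul]
      map_mul' := fun f g => by ext ξ x; simp [mul_smul] }
  adjoint f ξ η := by ext x; simp [mul_comm]

@[simp] theorem sectionCorrespondence_φ_apply (V : HermitianVectorBundle.{u, v} X) (α : X ≃ₜ X)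
    (f : C(X, ℂ)) (ξ : V.Section) (x : X) :
    (V.sectionCorrespondence α).φ f ξ x = f (α x) • ξ x := rfl

end HermitianVectorBundle

/-- A homeomorphism `α` is minimal if the only closed `E` with `α(E) ⊆ E` are `∅` and `X`. -/
def IsMinimalHomeomorph {X : Type u} [TopologicalSpace X] (α : X ≃ₜ X) : Prop :=
  ∀ E : Set X, IsClosed E → α '' E ⊆ E → E = ∅ ∨ E = Set.univ

end

/-!
Write `π` and `τ` for the universal covariant representation of `Γ(V, α)` in its Cuntz–Pimsner
algebra `𝓞`.  The relation used throughout is `π(f) τ(ξ) = τ(ξ) π(f ∘ α)`.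

Sections of `V` have a Parseval frame, a finite family `s` with `∑ sᵢ ⟨sᵢ, ξ⟩ = ξ`, obtained from
local orthonormal frames and a partition of unity (`exists_parseval_frame`).  Hence all operators
`φ(f)` are compact; since `φ` is injective, a representation is covariant if and only if
`∑ τ(sᵢ) τ(sᵢ)⋆ = π(1)` (`IsParsevalFrame.isCovariant_iff`).  Concrete covariant representations
on `ℓ²(X × ℕ)`, in which the section `ξ` maps the summand over `x` to the one over `α x` by means
of Cuntz isometries weighted with the coordinates of `ξ x`, show that `π` is injective.  Cut down
to an invariant set `Y` they give a representation which kills exactly the functions that vanish on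
`Y` (`exists_covariantRep`).

If `E` is closed with `α(E) ⊆ E` and is neither empty nor `X`, then `Y = ⋂ αⁿ(E)` is a nonempty
invariant set, and the kernel of the representation attached to `Y` is a nontrivial ideal of `𝓞`.

Conversely let `α` be minimal, so that there are no periodic points as `X` is infinite, and let `I`
be a closed ideal which contains some `b ≠ 0`.  The gauge action `τ(ξ) ↦ z τ(ξ)` permutes the
covariant representations and so acts on `𝓞`.  Averaging `b⋆ b` over roots of unity bounds below the
degree zero part `d₀` of every good approximation of `b⋆ b` by a finite sum of monomials `v w⋆` in
words (`exists_lt_norm_degree_zero`).  Compression with the words `tᵢ` of a fixed large length in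
the members of the frame turns `d₀` into a matrix of continuous functions, `tᵢ⋆ d₀ tⱼ = π(Fᵢⱼ)`,
and the norm of `d₀` is at most the supremum of the norms of the matrices `F(x)`
(`HasMatrix.norm_le`).  So there are `x` and contractions `w, w'` with `w⋆ d₀ w' = π(f)` and
`|f(x)|` large.  The terms of degree `k ≠ 0` are removed by multiplying on both sides with `π(h)`,
where `h` is a bump function at `x` with `h · (h ∘ αᵏ) = 0`.  Thus `I` contains an element so close
to some `π(f)` that it contains a nonzero `π(g)` (`exists_π_mem_of_ne_zero`).  The common zeros of
the functions in `I` form a closed set which `α` maps into itself; by minimality it is empty, hence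
`π(1) ∈ I` and `I = 𝓞` (`π_one_mem_of_isMinimal`).
-/

noncomputable section

/-! ### Parseval frames of sections -/

namespace HermitianVectorBundle

variable {X : Type u} [TopologicalSpace X] {V : HermitianVectorBundle.{u, v} X}

/-- A not necessarily continuous section `s` is continuous at `x`. -/
def SectionContinuousAt (s : ∀ x, V.Fiber x) (x : X) : Prop :=
  ContinuousAt (fun y => (⟨y, s y⟩ : V.Total)) x

namespace SectionContinuousAt

variable {s t : ∀ x, V.Fiber x} {x : X}

theorem congr (hs : SectionContinuousAt s x) (h : ∀ᶠ y in 𝓝 x, s y = t y) :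
    SectionContinuousAt t x := by
  refine ContinuousAt.congr hs ?_
  filter_upwards [h] with y hy
  rw [hy]

theorem add (hs : SectionContinuousAt s x) (ht : SectionContinuousAt t x) :
    SectionContinuousAt (fun y => s y + t y) x := by
  obtain ⟨n, e, hx, he⟩ := V.locally_trivial x
  refine (continuousAt_mk_iff hx _).2 ((((continuousAt_mk_iff hx s).1 hs).add
    ((continuousAt_mk_iff hx t).1 ht)).congr ?_)
  filter_upwards [e.open_baseSet.mem_nhds hx] with y hy
  exact ((he y hy).map_add _ _).symm

theorem smul {f : X → ℂ} (hf : ContinuousAt f x) (hs : SectionContinuousAt s x) :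
    SectionContinuousAt (fun y => f y • s y) x := by
  obtain ⟨n, e, hx, he⟩ := V.locally_trivial x
  refine (continuousAt_mk_iff hx _).2 ((hf.smul ((continuousAt_mk_iff hx s).1 hs)).congr ?_)
  filter_upwards [e.open_baseSet.mem_nhds hx] with y hy
  exact ((he y hy).map_smul _ _).symm

theorem sub (hs : SectionContinuousAt s x) (ht : SectionContinuousAt t x) :
    SectionContinuousAt (fun y => s y - t y) x := by
  simpa [sub_eq_add_neg] using hs.add (smul (f := fun _ => (-1 : ℂ)) continuousAt_const ht)

theorem sum {ι : Type*} (I : Finset ι) {s : ι → ∀ x, V.Fiber x}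
    (hs : ∀ i ∈ I, SectionContinuousAt (s i) x) :
    SectionContinuousAt (fun y => ∑ i ∈ I, s i y) x := by
  classical
  induction I using Finset.induction_on with
  | empty =>
    simp only [Finset.sum_empty]
    exact (continuous_zero' V).continuousAt
  | insert i I hi ih =>
    simp only [Finset.sum_insert hi]
    exact (hs i (by simp)).add (ih fun j hj => hs j (by simp [hj]))

theorem norm (hs : SectionContinuousAt s x) : ContinuousAt (fun y => ‖s y‖) x :=
  ContinuousAt.comp (g := fun v : V.Total => ‖v.snd‖) V.continuous_norm.continuousAt hs

theorem inner (hs : SectionContinuousAt s x) (ht : SectionContinuousAt t x) :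
    ContinuousAt (fun y => inner ℂ (s y) (t y)) x := by
  have hn : ∀ z : ℂ, ContinuousAt (fun x => ((‖s x + z • t x‖ : ℝ) : ℂ)) x := fun z =>
    Complex.continuous_ofReal.continuousAt.comp (hs.add (smul continuousAt_const ht)).norm
  have h1 := hn 1
  have h2 := hn (-1)
  have h3 := hn (-Complex.I)
  have h4 := hn Complex.I
  simp only [one_smul, neg_smul, ← sub_eq_add_neg] at h1 h2 h3 h4
  simp only [inner_eq_sum_norm_sq_div_four (𝕜 := ℂ)]
  exact ((((h1.pow 2).sub (h2.pow 2)).add (((h3.pow 2).sub (h4.pow 2)).mul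
    continuousAt_const)).div_const 4)

end SectionContinuousAt

/-- The coordinates of a chart identify the fibre linearly with the model space. -/
theorem exists_linearEquiv {n : ℕ} {e : Bundle.Trivialization (EuclideanSpace ℂ (Fin n))
    (Bundle.TotalSpace.proj : V.Total → X)} {y : X} (hy : y ∈ e.baseSet)
    (he : IsLinearMap ℂ fun v : V.Fiber y => (e ⟨y, v⟩).2) :
    ∃ L : V.Fiber y ≃ₗ[ℂ] EuclideanSpace ℂ (Fin n), ∀ v, L v = (e ⟨y, v⟩).2 := by
  refine ⟨LinearEquiv.ofBijective he.mk' ⟨fun v w hvw => ?_, fun w => ?_⟩, fun v => rfl⟩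
  · have h : e ⟨y, v⟩ = e ⟨y, w⟩ := by
      refine Prod.ext ?_ hvw
      rw [e.coe_fst' (x := (⟨y, v⟩ : V.Total)) hy, e.coe_fst' (x := (⟨y, w⟩ : V.Total)) hy]
    have h2 := e.toOpenPartialHomeomorph.injOn
      (e.mem_source.2 hy : (⟨y, v⟩ : V.Total) ∈ e.source)
      (e.mem_source.2 hy : (⟨y, w⟩ : V.Total) ∈ e.source) h
    simpa using h2
  · have h1 := e.apply_symm_apply' (x := w) hy
    have h2 : (e.toOpenPartialHomeomorph.symm (y, w)).proj = y := e.proj_symm_apply' hy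
    generalize e.toOpenPartialHomeomorph.symm (y, w) = z at h1 h2
    obtain ⟨y', v⟩ := z
    obtain rfl : y' = y := h2
    exact ⟨v, congrArg Prod.snd h1⟩

/-- The fibres are finite dimensional. -/
instance finiteDimensional_fiber (x : X) : FiniteDimensional ℂ (V.Fiber x) := by
  obtain ⟨n, e, hx, he⟩ := V.locally_trivial x
  obtain ⟨L, -⟩ := exists_linearEquiv hx (he x hx)
  exact L.symm.finiteDimensional

open InnerProductSpace in
/-- Local orthonormal frames, by the Gram–Schmidt process applied to a coordinate frame. -/
theorem exists_local_orthonormal_frame (x : X) :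
    ∃ (n : ℕ) (U : Set X) (b : Fin n → ∀ x, V.Fiber x), IsOpen U ∧ x ∈ U ∧
      (∀ i, ∀ y ∈ U, SectionContinuousAt (b i) y) ∧
      ∀ y ∈ U, ∀ v, ∑ i, inner ℂ (b i y) v • b i y = v := by
  classical
  obtain ⟨n, e, hx, he⟩ := V.locally_trivial x
  choose L hL using fun (y : X) (hy : y ∈ e.baseSet) => exists_linearEquiv hy (he y hy)
  let c : Fin n → ∀ y, V.Fiber y := fun i y =>
    if hy : y ∈ e.baseSet then (L y hy).symm (EuclideanSpace.basisFun (Fin n) ℂ i) else 0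
  have hc : ∀ i, ∀ y ∈ e.baseSet, SectionContinuousAt (c i) y := fun i y hy => by
    refine (continuousAt_mk_iff hy _).2 (ContinuousAt.congr
      (continuousAt_const (y := EuclideanSpace.basisFun (Fin n) ℂ i)) ?_)
    filter_upwards [e.open_baseSet.mem_nhds hy] with z hz
    rw [← hL z hz]
    simp [c, hz]
  let B : ∀ y, y ∈ e.baseSet → Module.Basis (Fin n) ℂ (V.Fiber y) := fun y hy =>
    (EuclideanSpace.basisFun (Fin n) ℂ).toBasis.map (L y hy).symm
  have hB : ∀ y (hy : y ∈ e.baseSet), (fun i => c i y) = B y hy := fun y hy => by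
    ext i
    simp [c, B, hy]
  have hne : ∀ i, ∀ y ∈ e.baseSet, gramSchmidt ℂ (fun i => c i y) i ≠ 0 := fun i y hy => by
    refine gramSchmidt_ne_zero i ?_
    rw [hB y hy]
    exact (B y hy).linearIndependent
  have hgs : ∀ i, ∀ y ∈ e.baseSet,
      SectionContinuousAt (fun y => gramSchmidt ℂ (fun i => c i y) i) y := fun i => by
    induction i using WellFoundedLT.induction with
    | ind i ih =>
      intro y hy
      simp only [gramSchmidt_def ℂ _ i, Submodule.starProjection_singleton]
      refine (hc i y hy).sub (SectionContinuousAt.sum _ fun j hj => ?_)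
      have hj' := ih j (Finset.mem_Iio.1 hj) y hy
      refine SectionContinuousAt.smul ((hj'.inner (hc i y hy)).div ?_ ?_) hj'
      · exact Complex.continuous_ofReal.continuousAt.comp (hj'.norm.pow 2)
      · simpa using hne j y hy
  refine ⟨n, e.baseSet, fun i y => gramSchmidtNormed ℂ (fun i => c i y) i, e.open_baseSet, hx,
    fun i y hy => ?_, fun y hy v => ?_⟩
  · refine SectionContinuousAt.smul (ContinuousAt.inv₀ ?_ ?_) (hgs i y hy)
    · exact Complex.continuous_ofReal.continuousAt.comp (hgs i y hy).norm
    · simpa using hne i y hy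
  · have hcard : Module.finrank ℂ (V.Fiber y) = Fintype.card (Fin n) := by
      rw [Module.finrank_eq_card_basis (B y hy)]
    have hb : ∀ i, gramSchmidtOrthonormalBasis hcard (fun i => c i y) i =
        gramSchmidtNormed ℂ (fun i => c i y) i := fun i =>
      gramSchmidtOrthonormalBasis_apply hcard (by simpa [gramSchmidtNormed] using hne i y hy)
    simp only [← hb]
    exact OrthonormalBasis.sum_repr' _ v

/-- A finite family of sections with `∑ sᵢ(x) ⟨sᵢ(x), v⟩ = v` for all `v` in the fibre over `x`. -/
def IsParsevalFrame {ι : Type*} [Fintype ι] (s : ι → V.Section) : Prop :=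
  ∀ x (v : V.Fiber x), ∑ i, inner ℂ (s i x) v • s i x = v

variable (V) in
/-- `Γ(V)` has a Parseval frame: local orthonormal frames are glued with the square roots of a
partition of unity. -/
theorem exists_parseval_frame [CompactSpace X] [T2Space X] :
    ∃ (ι : Type u) (_ : Fintype ι) (s : ι → V.Section), IsParsevalFrame s := by
  classical
  choose n U b hUo hxU hb hbv using fun x : X => exists_local_orthonormal_frame (V := V) x
  obtain ⟨I, hI⟩ := isCompact_univ.elim_finite_subcover U hUo
    fun x _ => Set.mem_iUnion.2 ⟨x, hxU x⟩
  obtain ⟨f, hf⟩ := PartitionOfUnity.exists_isSubordinate isClosed_univ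
    (fun x : I => U x) (fun x => hUo x) (fun x hx => by
      obtain ⟨j, hj, hxj⟩ := Set.mem_iUnion₂.1 (hI hx)
      exact Set.mem_iUnion.2 ⟨⟨j, hj⟩, hxj⟩)
  have hcont : ∀ (j : I) (i : Fin (n j)),
      Continuous fun x => (⟨x, ((√(f j x) : ℝ) : ℂ) • b j i x⟩ : V.Total) := fun j i => by
    refine continuous_iff_continuousAt.2 fun x => ?_
    by_cases hx : x ∈ tsupport (f j)
    · refine SectionContinuousAt.smul ?_ (hb j i x (hf j hx))
      fun_prop
    · refine SectionContinuousAt.congr ((continuous_zero' V).continuousAt (x := x)) ?_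
      filter_upwards [(isClosed_tsupport _).isOpen_compl.mem_nhds hx] with y hy
      rw [image_eq_zero_of_notMem_tsupport hy]
      simp
  refine ⟨Σ j : I, Fin (n j), inferInstance, fun p => ⟨_, hcont p.1 p.2⟩, fun x v => ?_⟩
  rw [Fintype.sum_sigma]
  have h1 : ∀ j : I, ∑ i : Fin (n j), inner ℂ (((√(f j x) : ℝ) : ℂ) • b j i x) v •
      ((√(f j x) : ℝ) : ℂ) • b j i x = ((f j x : ℝ) : ℂ) • v := fun j => by
    have h2 : ∀ i, inner ℂ (((√(f j x) : ℝ) : ℂ) • b j i x) v •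
        ((√(f j x) : ℝ) : ℂ) • b j i x = ((f j x : ℝ) : ℂ) • (inner ℂ (b j i x) v • b j i x) :=
      fun i => by
        rw [inner_smul_left, Complex.conj_ofReal, smul_smul, smul_smul]
        congr 1
        have := Real.mul_self_sqrt (f.nonneg j x)
        rw [← this]
        push_cast
        rw [Real.sqrt_mul_self (Real.sqrt_nonneg _)]
        ring
    rw [Finset.sum_congr rfl fun i _ => h2 i, ← Finset.smul_sum]
    by_cases hx : x ∈ U j
    · rw [hbv j x hx]
    · have : f j x = 0 := image_eq_zero_of_notMem_tsupport fun h => hx (hf j h)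
      rw [this]
      simp
  rw [Finset.sum_congr rfl fun j _ => h1 j, ← Finset.sum_smul]
  have h3 := f.sum_finsupport' (x₀ := x) (Set.mem_univ x) (Finset.subset_univ _)
  have h4 : ∑ j : I, ((f j x : ℝ) : ℂ) = 1 := by exact_mod_cast h3
  rw [h4, one_smul]

end HermitianVectorBundle

/-! ### Covariance in terms of a Parseval frame -/

namespace CStarCorrespondence

variable {A : Type u} {E : Type v} [CommCStarAlgebra A] [PartialOrder A] [StarOrderedRing A]
  [NormedAddCommGroup E] [NormedSpace ℂ E] [CompleteSpace E] [Module A E] [CStarModule A E]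

/-- Right linearity of `τ` follows from compatibility with the inner products. -/
theorem Representation.τ_smul {C : CStarCorrespondence A E} {B : Type*} [NonUnitalCStarAlgebra B]
    (ρ : C.Representation B) (a : A) (ξ : E) : ρ.τ (a • ξ) = ρ.τ ξ * ρ.π a := by
  rw [← sub_eq_zero, ← CStarRing.star_mul_self_eq_zero_iff]
  simp only [star_sub, star_mul, sub_mul, mul_sub, ← ρ.map_inner, mul_assoc]
  simp only [← mul_assoc, ← ρ.map_inner, ← map_star, ← map_mul, CStarModule.inner_op_smul_right,
    CStarModule.inner_op_smul_left]
  simp only [mul_assoc, ← map_sub]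
  simp only [mul_comm, mul_left_comm, sub_self, map_zero]

end CStarCorrespondence

namespace HermitianVectorBundle

variable {X : Type u} [TopologicalSpace X] {V : HermitianVectorBundle.{u, v} X}

namespace Section

variable (V) in
/-- Evaluation of sections at a point, as a linear map. -/
def evalₗ (x : X) : V.Section →ₗ[ℂ] V.Fiber x where
  toFun s := s x
  map_add' _ _ := rfl
  map_smul' _ _ := rfl

theorem sum_apply {ι : Type*} (I : Finset ι) (s : ι → V.Section) (x : X) :
    (∑ i ∈ I, s i) x = ∑ i ∈ I, s i x :=
  map_sum (evalₗ V x) s I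

end Section

namespace IsParsevalFrame

variable {ι : Type*} [Fintype ι] {s : ι → V.Section} (hs : IsParsevalFrame s)
include hs

theorem sum_smul (ξ : V.Section) : ∑ i, ⟪s i, ξ⟫_(C(X, ℂ)) • s i = ξ := by
  ext x
  rw [Section.sum_apply]
  exact hs x _

theorem exists_ne_zero (x : X) [Nontrivial (V.Fiber x)] : ∃ i, s i x ≠ 0 := by
  by_contra! h
  obtain ⟨v, hv⟩ := exists_ne (0 : V.Fiber x)
  exact hv (by simpa [h] using (hs x v).symm)

variable [CompactSpace X]

/-- The left action of a function is a finite sum of rank one operators. -/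
theorem eq_sum_rankOne (α : X ≃ₜ X) (f : C(X, ℂ)) :
    (V.sectionCorrespondence α).φ f =
      ∑ i, CStarModule.rankOne C(X, ℂ) ((V.sectionCorrespondence α).φ f (s i)) (s i) := by
  ext ξ x
  have h := hs x (ξ x)
  rw [_root_.sum_apply, Section.sum_apply, sectionCorrespondence_φ_apply]
  conv_lhs => rw [← h, Finset.smul_sum]
  refine Finset.sum_congr rfl fun i _ => ?_
  change _ = inner ℂ (s i x) (ξ x) • (f (α x) • s i x)
  rw [smul_comm]

theorem φ_mem_compacts (α : X ≃ₜ X) (f : C(X, ℂ)) :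
    (V.sectionCorrespondence α).φ f ∈ CStarModule.compacts C(X, ℂ) V.Section := by
  rw [hs.eq_sum_rankOne α f]
  exact sum_mem fun i _ => CStarModule.rankOne_mem _ _

theorem φ_injective (hV : ∀ x, Nontrivial (V.Fiber x)) (α : X ≃ₜ X) {f : C(X, ℂ)}
    (hf : (V.sectionCorrespondence α).φ f = 0) : f = 0 := by
  ext x
  obtain ⟨i, hi⟩ := hs.exists_ne_zero (α.symm x)
  have h : (V.sectionCorrespondence α).φ f (s i) (α.symm x) = 0 := by rw [hf]; rfl
  rw [sectionCorrespondence_φ_apply, α.apply_symm_apply, smul_eq_zero] at h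
  exact h.resolve_right hi

/-- Katsura's ideal is everything, as `φ` is injective with values in the compact operators. -/
theorem mem_katsuraIdeal (hV : ∀ x, Nontrivial (V.Fiber x)) (α : X ≃ₜ X) (f : C(X, ℂ)) :
    f ∈ (V.sectionCorrespondence α).katsuraIdeal :=
  ⟨hs.φ_mem_compacts α f, fun b hb => by rw [hs.φ_injective hV α hb, mul_zero]⟩

theorem isCovariant_iff (hV : ∀ x, Nontrivial (V.Fiber x)) {α : X ≃ₜ X} {B : Type*}
    [NonUnitalCStarAlgebra B] (ρ : (V.sectionCorrespondence α).Representation B) :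
    ρ.IsCovariant ↔ ∑ i, ρ.τ (s i) * star (ρ.τ (s i)) = ρ.π 1 := by
  have hφ1 : ∀ ξ, (V.sectionCorrespondence α).φ 1 ξ = ξ := fun ξ => by
    ext x
    simp
  constructor
  · rintro ⟨ψ, hψ, hcov⟩
    rw [hcov 1 (hs.mem_katsuraIdeal hV α 1)]
    simp only [← hψ, ← map_sum]
    congr 1
    ext1
    change _ = (V.sectionCorrespondence α).φ 1
    refine Eq.trans ?_ (hs.eq_sum_rankOne α 1).symm
    simp [hφ1]
  · intro h
    let τ' : V.Section →L[ℂ] B := ρ.τ.mkContinuous 1 fun ξ => by simpa using ρ.norm_τ_le ξ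
    -- `ψ T = ∑ τ(T sᵢ) τ(sᵢ)⋆` is defined and continuous on all operators
    let ψ : (V.Section →L[ℂ] V.Section) →L[ℂ] B :=
      ∑ i, ((ContinuousLinearMap.mul ℂ B).flip (star (ρ.τ (s i)))).comp
        (τ'.comp (ContinuousLinearMap.apply ℂ V.Section (s i)))
    have hψ : ∀ T, ψ T = ∑ i, ρ.τ (T (s i)) * star (ρ.τ (s i)) := fun T => by
      simp [ψ, τ']
    refine ⟨ψ.comp (Submodule.subtypeL _), fun ξ η => ?_, fun f hf => ?_⟩
    · change ψ _ = _
      rw [hψ]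
      conv_rhs => rw [← hs.sum_smul η, map_sum, star_sum, Finset.mul_sum]
      refine Finset.sum_congr rfl fun i _ => ?_
      change ρ.τ (⟪η, s i⟫_(C(X, ℂ)) • ξ) * _ = _
      have hst : star ⟪s i, η⟫_(C(X, ℂ)) = ⟪η, s i⟫_(C(X, ℂ)) := by ext x; simp
      rw [ρ.τ_smul, ρ.τ_smul, star_mul, ← map_star ρ.π, hst, mul_assoc]
    · change _ = ψ ((V.sectionCorrespondence α).φ f)
      rw [hψ]
      simp only [← ρ.map_left, mul_assoc]
      rw [← Finset.mul_sum, h, ← map_mul, mul_one]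

end IsParsevalFrame

end HermitianVectorBundle

/-! ### Representations on Hilbert spaces of square summable families -/

section WeightedComposition

variable {ι : Type*} {H : Type*} [NormedAddCommGroup H] [InnerProductSpace ℂ H]

theorem lp_sum_weightedComp_le {e : ι → ι} (he : e.Injective) {A : ι → H →L[ℂ] H} {C : ℝ}
    (hC : 0 ≤ C) (hA : ∀ z, ‖A z‖ ≤ C) (g : lp (fun _ : ι => H) 2) (I : Finset ι) :
    ∑ z ∈ I, ‖A z (g (e z))‖ ^ (2 : ℝ≥0∞).toReal ≤ (C * ‖g‖) ^ (2 : ℝ≥0∞).toReal := by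
  classical
  have hp : 0 < (2 : ℝ≥0∞).toReal := by norm_num
  calc ∑ z ∈ I, ‖A z (g (e z))‖ ^ (2 : ℝ≥0∞).toReal
      ≤ ∑ z ∈ I, C ^ (2 : ℝ≥0∞).toReal * ‖g (e z)‖ ^ (2 : ℝ≥0∞).toReal := by
        refine Finset.sum_le_sum fun z _ => ?_
        rw [← Real.mul_rpow hC (norm_nonneg _)]
        exact Real.rpow_le_rpow (norm_nonneg _) ((A z).le_of_opNorm_le (hA z) _) hp.le
    _ = C ^ (2 : ℝ≥0∞).toReal * ∑ w ∈ I.image e, ‖g w‖ ^ (2 : ℝ≥0∞).toReal := by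
        rw [← Finset.mul_sum, Finset.sum_image fun _ _ _ _ h => he h]
    _ ≤ (C * ‖g‖) ^ (2 : ℝ≥0∞).toReal := by
        rw [Real.mul_rpow hC (norm_nonneg _)]
        gcongr
        exact lp.sum_rpow_le_norm_rpow hp g _

/-- The weighted composition operator `(T g)(z) = A_z (g (e z))` on `ℓ²(ι, H)`, for an injective
map `e` and a family of operators bounded by `C`. -/
def weightedComp (e : ι → ι) (he : e.Injective) (A : ι → H →L[ℂ] H) (C : ℝ) (hC : 0 ≤ C)
    (hA : ∀ z, ‖A z‖ ≤ C) : lp (fun _ : ι => H) 2 →L[ℂ] lp (fun _ : ι => H) 2 :=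
  LinearMap.mkContinuous
    { toFun := fun g => ⟨fun z => A z (g (e z)),
        memℓp_gen' fun I => lp_sum_weightedComp_le he hC hA g I⟩
      map_add' := fun g h => by ext z; simp; rfl
      map_smul' := fun c g => by ext z; simp }
    C fun g => lp.norm_le_of_forall_sum_le (by norm_num) (by positivity)
      fun I => lp_sum_weightedComp_le he hC hA g I

@[simp] theorem weightedComp_apply {e : ι → ι} {he : e.Injective} {A : ι → H →L[ℂ] H} {C : ℝ}
    {hC : 0 ≤ C} {hA : ∀ z, ‖A z‖ ≤ C} (g : lp (fun _ : ι => H) 2) (z : ι) :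
    weightedComp e he A C hC hA g z = A z (g (e z)) := rfl

theorem star_weightedComp [CompleteSpace H] (e : ι ≃ ι) {A : ι → H →L[ℂ] H} {C : ℝ}
    {hC : 0 ≤ C} {hA : ∀ z, ‖A z‖ ≤ C} :
    star (weightedComp e e.injective A C hC hA) =
      weightedComp e.symm e.symm.injective (fun y => star (A (e.symm y))) C hC
        (fun y => by rw [norm_star]; exact hA _) := by
  symm
  rw [ContinuousLinearMap.star_eq_adjoint, ContinuousLinearMap.eq_adjoint_iff]
  intro g h
  rw [lp.inner_eq_tsum, lp.inner_eq_tsum, ← e.tsum_eq]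
  refine tsum_congr fun z => ?_
  simp [ContinuousLinearMap.star_eq_adjoint, ContinuousLinearMap.adjoint_inner_left]

end WeightedComposition

/-- A Cuntz family: isometries with orthogonal ranges which sum to the whole space. -/
theorem exists_cuntz_family (κ : Type*) [Countable κ] [Infinite κ] (n : ℕ) [NeZero n] :
    ∃ S : Fin n → (lp (fun _ : κ => ℂ) 2 →L[ℂ] lp (fun _ : κ => ℂ) 2),
      (∀ i j, star (S i) * S j = if i = j then 1 else 0) ∧ ∑ i, S i * star (S i) = 1 := by
  classical
  obtain ⟨σ⟩ : Nonempty (Fin n × κ ≃ κ) := nonempty_equiv_of_countable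
  have hinj : ∀ i, Function.Injective fun k => σ (i, k) := fun i k l h => by
    simpa using h
  -- the adjoint of the isometry mapping the basis vector `k` to the basis vector `σ (i, k)`
  let R : Fin n → (lp (fun _ : κ => ℂ) 2 →L[ℂ] lp (fun _ : κ => ℂ) 2) := fun i =>
    weightedComp (fun k => σ (i, k)) (hinj i) (fun _ => 1) 1 zero_le_one
      (fun _ => ContinuousLinearMap.norm_id_le)
  have hR : ∀ i g k, R i g k = g (σ (i, k)) := fun i g k => rfl
  have hcoord : ∀ (g : lp (fun _ : κ => ℂ) 2) k, inner ℂ (lp.single 2 k (1 : ℂ)) g = g k :=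
    fun g k => by simp [lp.inner_single_left]
  have hext : ∀ T T' : lp (fun _ : κ => ℂ) 2 →L[ℂ] lp (fun _ : κ => ℂ) 2,
      (∀ g k, inner ℂ (lp.single 2 k (1 : ℂ)) (T g) = inner ℂ (lp.single 2 k (1 : ℂ)) (T' g)) →
        T = T' := fun T T' h => by
    ext g k
    simpa only [hcoord] using h g k
  have hS : ∀ i k, star (R i) (lp.single 2 k 1) = lp.single 2 (σ (i, k)) 1 := fun i k => by
    refine ext_inner_right ℂ fun g => ?_
    rw [ContinuousLinearMap.star_eq_adjoint, ContinuousLinearMap.adjoint_inner_left, hcoord,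
      hcoord, hR]
  have hRS : ∀ i j k, R i (lp.single 2 (σ (j, k)) 1) = if i = j then lp.single 2 k 1 else 0 :=
    fun i j k => by
      ext l
      rw [hR]
      by_cases hij : i = j
      · subst hij
        by_cases hl : l = k
        · subst hl; simp
        · simp [hl]
      · simp [hij]
  refine ⟨fun i => star (R i), fun i j => hext _ _ fun g k => ?_, hext _ _ fun g k => ?_⟩
  · have h : star (star (R i)) * star (R j) = star (R j * star (R i)) := by simp
    rw [h, ContinuousLinearMap.star_eq_adjoint (R j * star (R i)),
      ContinuousLinearMap.adjoint_inner_right, mul_apply_eq_comp, hS, hRS]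
    by_cases hij : i = j
    · subst hij; simp
    · simp [hij, Ne.symm hij]
  · obtain ⟨⟨j, k⟩, rfl⟩ := σ.surjective k
    simp only [star_star, sum_apply, mul_apply_eq_comp, inner_sum]
    rw [Finset.sum_eq_single j]
    · rw [ContinuousLinearMap.star_eq_adjoint, ContinuousLinearMap.adjoint_inner_right, hRS,
        if_pos rfl, hcoord, hR, one_apply_eq_self, hcoord]
    · intro i _ hij
      rw [ContinuousLinearMap.star_eq_adjoint, ContinuousLinearMap.adjoint_inner_right, hRS,
        if_neg hij, inner_zero_left]
    · simp

/-- The one-point case of a covariant representation: a nonzero finite dimensional Hilbert space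
`W` is represented on `ℓ²(κ)` by multiples of isometries. -/
theorem exists_cuntz_map (κ : Type*) [Countable κ] [Infinite κ] (W : Type*) [NormedAddCommGroup W]
    [InnerProductSpace ℂ W] [FiniteDimensional ℂ W] [Nontrivial W] :
    ∃ a : W →ₗ[ℂ] (lp (fun _ : κ => ℂ) 2 →L[ℂ] lp (fun _ : κ => ℂ) 2),
      (∀ v w, star (a v) * a w = inner ℂ v w • 1) ∧
      ∀ {ι : Type u} [Fintype ι] (s : ι → W), (∀ v, ∑ i, inner ℂ (s i) v • s i = v) →
        ∑ i, a (s i) * star (a (s i)) = 1 := by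
  classical
  have : NeZero (Module.finrank ℂ W) := ⟨Module.finrank_pos.ne'⟩
  obtain ⟨S, hS, hS1⟩ := exists_cuntz_family κ (Module.finrank ℂ W)
  let b := stdOrthonormalBasis ℂ W
  let a : W →ₗ[ℂ] (lp (fun _ : κ => ℂ) 2 →L[ℂ] lp (fun _ : κ => ℂ) 2) :=
    { toFun := fun v => ∑ i, inner ℂ (b i) v • S i
      map_add' := fun v w => by simp [add_smul, Finset.sum_add_distrib]
      map_smul' := fun c v => by simp [mul_smul, Finset.smul_sum] }
  have ha : ∀ v, a v = ∑ i, inner ℂ (b i) v • S i := fun v => rfl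
  refine ⟨a, fun v w => ?_, fun s hs => ?_⟩
  · rw [← b.sum_inner_mul_inner v w, Finset.sum_smul]
    simp only [ha, star_sum, star_smul, Finset.sum_mul, Finset.mul_sum, smul_mul_smul_comm, hS]
    simp
  · have h1 : ∀ i, a (s i) * star (a (s i)) =
        ∑ k, ∑ l, (inner ℂ (b k) (s i) * inner ℂ (s i) (b l)) • (S k * star (S l)) := fun i => by
      simp only [ha, star_sum, star_smul, Finset.sum_mul, Finset.mul_sum, smul_mul_smul_comm]
      rw [Finset.sum_comm]
      simp
    rw [Finset.sum_congr rfl fun i _ => h1 i, Finset.sum_comm, ← hS1]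
    refine Finset.sum_congr rfl fun k _ => ?_
    rw [Finset.sum_comm]
    have h2 : ∀ l, ∑ i, (inner ℂ (b k) (s i) * inner ℂ (s i) (b l)) • (S k * star (S l)) =
        (if k = l then (1 : ℂ) else 0) • (S k * star (S l)) := fun l => by
      rw [← Finset.sum_smul, ← orthonormal_iff_ite.1 b.orthonormal k l]
      congr 1
      conv_rhs => rw [← hs (b l), inner_sum]
      refine Finset.sum_congr rfl fun i _ => ?_
      rw [inner_smul_right, mul_comm]
    rw [Finset.sum_congr rfl fun l _ => h2 l]
    simp

namespace HermitianVectorBundle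

variable {X : Type u} [TopologicalSpace X] [CompactSpace X] {V : HermitianVectorBundle.{u, v} X}

/-- For an `α`-invariant subset `Y` there is a covariant representation on `ℓ²(X × ℕ)` in which
`f` acts as multiplication by `f` on `Y`, and by zero off `Y`.  A section `ξ` maps the summand
`ℓ²(ℕ)` over `x` to that over `α x` by a multiple of an isometry which is given by `ξ x`. -/
theorem exists_covariantRep (V : HermitianVectorBundle.{u, v} X)
    (hV : ∀ x, Nontrivial (V.Fiber x)) (α : X ≃ₜ X) {ι : Type u} [Fintype ι] {s : ι → V.Section}
    (hs : IsParsevalFrame s) (Y : Set X) (hY : ∀ x, α x ∈ Y ↔ x ∈ Y) :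
    ∃ ρ : (V.sectionCorrespondence α).CovariantRep,
      ∀ f : C(X, ℂ), ρ.rep.π f = 0 ↔ ∀ x ∈ Y, f x = 0 := by
  classical
  choose a ha ha1 using fun x => exists_cuntz_map.{u} (ULift.{v} ℕ) (V.Fiber x)
  let K := lp (fun _ : ULift.{v} ℕ => ℂ) 2
  let χ : X → ℂ := fun x => if x ∈ Y then 1 else 0
  have hχ : ∀ x, χ (α x) = χ x := fun x => by simp [χ, hY]
  have hχ' : ∀ x, χ (α.symm x) = χ x := fun x => by rw [← hχ, α.apply_symm_apply]
  have hχn : ∀ x, ‖χ x‖ ≤ 1 := fun x => by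
    by_cases hx : x ∈ Y <;> simp [χ, hx]
  have hχs : ∀ x, starRingEnd ℂ (χ x) = χ x := fun x => by
    by_cases hx : x ∈ Y <;> simp [χ, hx]
  have hχm : ∀ x, χ x * χ x = χ x := fun x => by
    by_cases hx : x ∈ Y <;> simp [χ, hx]
  let G : V.Section → X → K →L[ℂ] K := fun ξ x => a x (ξ x)
  have hGn : ∀ ξ x, ‖G ξ x‖ ≤ ‖ξ‖ := fun ξ x => by
    refine le_trans ?_ (Section.norm_apply_le ξ x)
    refine (pow_le_pow_iff_left₀ (norm_nonneg _) (norm_nonneg _) two_ne_zero).mp ?_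
    rw [pow_two, ← CStarRing.norm_star_mul_self, ha, inner_self_eq_norm_sq_to_K, norm_smul]
    refine (mul_le_of_le_one_right (norm_nonneg _) ContinuousLinearMap.norm_id_le).trans ?_
    simp
  have hG : ∀ ξ η x, star (G ξ x) * G η x = ⟪ξ, η⟫_(C(X, ℂ)) x • 1 := fun ξ η x => ha x _ _
  let L := lp (fun _ : X => K) 2
  let π : C(X, ℂ) → (L →L[ℂ] L) := fun f =>
    weightedComp (Equiv.refl X) (Equiv.injective _) (fun z => (χ z * f z) • 1) ‖f‖ (norm_nonneg _)
      fun z => by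
        rw [norm_smul, norm_mul]
        refine (mul_le_of_le_one_right (by positivity) ContinuousLinearMap.norm_id_le).trans ?_
        exact (mul_le_of_le_one_left (norm_nonneg _) (hχn z)).trans (f.norm_coe_le_norm z)
  let τ : V.Section → (L →L[ℂ] L) := fun ξ =>
    weightedComp α.symm.toEquiv (Equiv.injective _) (fun z => χ z • G ξ (α.symm z)) ‖ξ‖
      (norm_nonneg _) fun z => by
        rw [norm_smul]
        exact (mul_le_of_le_one_left (norm_nonneg _) (hχn z)).trans (hGn ξ _)
  have hπ : ∀ f g z, π f g z = (χ z * f z) • g z := fun f g z => rfl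
  have hτ : ∀ ξ g z, τ ξ g z = χ z • G ξ (α.symm z) (g (α.symm z)) := fun ξ g z => rfl
  have hπs : ∀ f g z, star (π f) g z = (χ z * star (f z)) • g z := fun f g z => by
    rw [star_weightedComp, weightedComp_apply]
    simp [hχs]
  have hτs : ∀ ξ g z, star (τ ξ) g z = χ z • star (G ξ z) (g (α z)) := fun ξ g z => by
    rw [star_weightedComp, weightedComp_apply]
    change (star (χ (α z) • G ξ (α.symm (α z)))) (g (α z)) = _
    rw [α.symm_apply_apply, hχ, star_smul]
    simp [hχs]
  let πh : C(X, ℂ) →⋆ₙₐ[ℂ] (L →L[ℂ] L) :=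
    { toFun := π
      map_smul' := fun c f => by
        ext1 g; ext1; funext z
        change π (c • f) g z = c • π f g z
        simp [hπ, smul_smul, mul_left_comm]
      map_zero' := by ext1 g; ext1; funext z; simp [hπ]
      map_add' := fun f f' => by ext1 g; ext1; funext z; simp [hπ, mul_add, add_smul]
      map_mul' := fun f f' => by
        ext1 g; ext1; funext z
        simp only [hπ, mul_apply_eq_comp, ContinuousMap.mul_apply, smul_smul]
        rw [mul_mul_mul_comm, hχm]
      map_star' := fun f => by ext1 g; ext1; funext z; rw [hπs, hπ]; rfl }
  let τh : V.Section →ₗ[ℂ] (L →L[ℂ] L) :=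
    { toFun := τ
      map_add' := fun ξ η => by ext1 g; ext1; funext z; simp [hτ, G]
      map_smul' := fun c ξ => by
        ext1 g; ext1; funext z
        change τ (c • ξ) g z = c • τ ξ g z
        simp [hτ, G, smul_comm c] }
  let ρ : (V.sectionCorrespondence α).Representation (L →L[ℂ] L) :=
    { π := πh
      τ := τh
      map_inner := fun ξ η => by
        ext1 g; ext1; funext z
        change π _ g z = star (τ ξ) (τ η g) z
        rw [hπ, hτs, hτ, α.symm_apply_apply, hχ, map_smul, ← mul_apply_eq_comp, hG,
          smul_smul, hχm, mul_smul]
        rfl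
      map_left := fun f ξ => by
        ext1 g; ext1; funext z
        change π f (τ ξ g) z = τ _ g z
        rw [hπ, hτ, hτ, smul_smul]
        simp only [G]
        rw [sectionCorrespondence_φ_apply, α.apply_symm_apply, map_smul, mul_right_comm, hχm,
          mul_smul]
        rfl }
  have hcov : ρ.IsCovariant := by
    refine (hs.isCovariant_iff hV ρ).2 ?_
    ext1 g; ext1; funext z
    change (∑ i, τ (s i) * star (τ (s i))) g z = π 1 g z
    rw [sum_apply, lp.coeFn_sum, Finset.sum_apply]
    simp only [mul_apply_eq_comp, hτ, hτs, α.apply_symm_apply, hχ', map_smul,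
      smul_smul, hχm]
    rw [← Finset.smul_sum, hπ]
    simp only [← mul_apply_eq_comp, ← sum_apply, G]
    rw [ha1 (α.symm z) (fun i => s i (α.symm z)) (hs _)]
    simp
  refine ⟨⟨L →L[ℂ] L, ρ, hcov⟩, fun f => ⟨fun h x hx => ?_, fun h => ?_⟩⟩
  · have h1 : π f (lp.single 2 x (lp.single 2 default 1)) x default = 0 := by
      change π f = 0 at h
      rw [h]
      rfl
    rw [hπ] at h1
    simp only [χ, if_pos hx, one_mul, lp.single_apply_self] at h1
    change f x • (lp.single 2 default 1 : K) default = 0 at h1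
    simpa using h1
  · change π f = 0
    ext1 g; ext1; funext z
    rw [hπ]
    by_cases hz : z ∈ Y
    · simp [h z hz]
    · simp [χ, hz]

end HermitianVectorBundle

/-! ### Words, monomials and degrees in a represented algebra -/

namespace HermitianVectorBundle

section Pullback

variable {X : Type u} [TopologicalSpace X]

/-- The function `f ∘ αᵏ`. -/
def pullback (α : X ≃ₜ X) (k : ℤ) (f : C(X, ℂ)) : C(X, ℂ) := f.comp ((α ^ k : X ≃ₜ X) : C(X, X))

@[simp] theorem pullback_apply (α : X ≃ₜ X) (k : ℤ) (f : C(X, ℂ)) (x : X) :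
    pullback α k f x = f ((α ^ k) x) := rfl

theorem pullback_pullback (α : X ≃ₜ X) (k l : ℤ) (f : C(X, ℂ)) :
    pullback α k (pullback α l f) = pullback α (l + k) f := by
  ext x
  simp only [pullback_apply, zpow_add]
  rfl

@[simp] theorem pullback_zero (α : X ≃ₜ X) (f : C(X, ℂ)) : pullback α 0 f = f := rfl

theorem star_pullback (α : X ≃ₜ X) (k : ℤ) (f : C(X, ℂ)) :
    star (pullback α k f) = pullback α k (star f) := rfl

end Pullback

variable {X : Type u} [TopologicalSpace X] [CompactSpace X] {V : HermitianVectorBundle.{u, v} X}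
  {α : X ≃ₜ X} {B : Type*} [NonUnitalCStarAlgebra B]
  (ρ : (V.sectionCorrespondence α).Representation B)

/-- An element `y` has degree `k` for a representation if `π(f) y = y π(f ∘ αᵏ)`. -/
def HasDegree (k : ℤ) (y : B) : Prop := ∀ f, ρ.π f * y = y * ρ.π (pullback α k f)

/-- The words `τ(ξ₁) ⋯ τ(ξₙ) π(f)` of length `n`. -/
inductive IsWord : ℕ → B → Prop
  | base (f : C(X, ℂ)) : IsWord 0 (ρ.π f)
  | step (ξ : V.Section) {n : ℕ} {w : B} (h : IsWord n w) : IsWord (n + 1) (ρ.τ ξ * w)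

/-- The monomials `v w⋆` in two words. -/
def monomials : Set B := {y | ∃ m n v w, IsWord ρ m v ∧ IsWord ρ n w ∧ y = v * star w}

variable {ρ}

namespace HasDegree

variable {k l : ℤ} {y y' : B}

theorem zero : HasDegree ρ k 0 := fun f => by simp

theorem add (h : HasDegree ρ k y) (h' : HasDegree ρ k y') : HasDegree ρ k (y + y') := fun f => by
  rw [mul_add, add_mul, h f, h' f]

theorem smul (c : ℂ) (h : HasDegree ρ k y) : HasDegree ρ k (c • y) := fun f => by
  rw [mul_smul_comm, smul_mul_assoc, h f]

theorem mul (h : HasDegree ρ k y) (h' : HasDegree ρ l y') : HasDegree ρ (k + l) (y * y') :=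
  fun f => by
    rw [← mul_assoc, h f, mul_assoc, h', pullback_pullback, mul_assoc]

theorem star (h : HasDegree ρ k y) : HasDegree ρ (-k) (star y) := fun f => by
  have h1 := congrArg Star.star (h (pullback α (-k) (Star.star f)))
  rw [star_mul, star_mul, ← map_star, ← map_star, pullback_pullback, neg_add_cancel,
    pullback_zero, star_star, star_pullback, star_star] at h1
  exact h1.symm

theorem sum {κ : Type*} {I : Finset κ} {y : κ → B} (h : ∀ i ∈ I, HasDegree ρ k (y i)) :
    HasDegree ρ k (∑ i ∈ I, y i) := fun f => by
  rw [Finset.mul_sum, Finset.sum_mul]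
  exact Finset.sum_congr rfl fun i hi => h i hi f

end HasDegree

theorem hasDegree_τ (ξ : V.Section) : HasDegree ρ 1 (ρ.τ ξ) := fun f => by
  rw [ρ.map_left, ← ρ.τ_smul]
  rfl

namespace IsWord

variable {m n : ℕ} {v w : B}

theorem hasDegree (h : IsWord ρ n w) : HasDegree ρ n w := by
  induction h with
  | base f => exact fun g => by simp [← map_mul, mul_comm]
  | step ξ h ih =>
    push_cast
    rw [add_comm]
    exact (hasDegree_τ ξ).mul ih

theorem π_mul (f : C(X, ℂ)) (h : IsWord ρ n w) : IsWord ρ n (ρ.π f * w) := by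
  cases h with
  | base g => rw [← map_mul]; exact base _
  | step ξ h => rw [← mul_assoc, ρ.map_left]; exact step _ h

theorem one_mul (h : IsWord ρ n w) : ρ.π 1 * w = w := by
  cases h with
  | base g => rw [← map_mul, _root_.one_mul]
  | step ξ h =>
    rw [← mul_assoc, ρ.map_left]
    congr 2
    ext x
    simp

theorem mul (hv : IsWord ρ m v) (hw : IsWord ρ n w) : IsWord ρ (m + n) (v * w) := by
  induction hv with
  | base f => rw [zero_add]; exact hw.π_mul f
  | step ξ h ih => rw [mul_assoc, add_right_comm]; exact step ξ ih

theorem split (hw : IsWord ρ (m + n) w) :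
    ∃ w₁ w₂, IsWord ρ m w₁ ∧ IsWord ρ n w₂ ∧ w = w₁ * w₂ := by
  induction m generalizing w with
  | zero =>
    rw [zero_add] at hw
    exact ⟨_, w, base 1, hw, hw.one_mul.symm⟩
  | succ m ih =>
    rw [add_right_comm] at hw
    cases hw with
    | step ξ h =>
      obtain ⟨w₁, w₂, h₁, h₂, rfl⟩ := ih h
      exact ⟨_, w₂, step ξ h₁, h₂, (mul_assoc _ _ _).symm⟩

theorem star_mul_same (hv : IsWord ρ n v) (hw : IsWord ρ n w) : ∃ f, star v * w = ρ.π f := by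
  induction hv generalizing w with
  | base f =>
    cases hw with
    | base g => exact ⟨star f * g, by rw [map_mul, map_star]⟩
  | @step ξ n v h ih =>
    cases hw with
    | @step η _ w h' =>
      obtain ⟨f, hf⟩ := ih (h'.π_mul ⟪ξ, η⟫_(C(X, ℂ)))
      refine ⟨f, ?_⟩
      rw [← hf, ρ.map_inner, star_mul]
      simp only [mul_assoc]

/-- Words of length `m ≥ n` compress the monomials in two words of length `n` to functions. -/
theorem compress_monomial {v' w' : B} (hv : IsWord ρ n v) (hv' : IsWord ρ n v')
    (hnm : n ≤ m) (hw : IsWord ρ m w) (hw' : IsWord ρ m w') :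
    ∃ f, star w * (v * star v') * w' = ρ.π f := by
  obtain ⟨k, rfl⟩ := Nat.exists_eq_add_of_le hnm
  obtain ⟨w₁, w₂, h₁, h₂, rfl⟩ := hw.split
  obtain ⟨w₁', w₂', h₁', h₂', rfl⟩ := hw'.split
  obtain ⟨f, hf⟩ := h₁.star_mul_same hv
  obtain ⟨g, hg⟩ := hv'.star_mul_same h₁'
  obtain ⟨p, hp⟩ := h₂.star_mul_same ((h₂'.π_mul g).π_mul f)
  refine ⟨p, ?_⟩
  rw [← hp, ← hf, ← hg, star_mul]
  simp only [mul_assoc]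

end IsWord

theorem τ_mul_π_one (ξ : V.Section) : ρ.τ ξ * ρ.π 1 = ρ.τ ξ := by
  rw [← ρ.τ_smul, one_smul]

theorem π_mem_monomials (f : C(X, ℂ)) : ρ.π f ∈ monomials ρ :=
  ⟨0, 0, ρ.π f, ρ.π 1, .base f, .base 1, by rw [← map_star, ← map_mul, star_one, mul_one]⟩

theorem τ_mem_monomials (ξ : V.Section) : ρ.τ ξ ∈ monomials ρ :=
  ⟨1, 0, ρ.τ ξ * ρ.π 1, ρ.π 1, .step ξ (.base 1), .base 1, by
    rw [← map_star, star_one, τ_mul_π_one, τ_mul_π_one]⟩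

theorem star_mem_monomials {y : B} (hy : y ∈ monomials ρ) : star y ∈ monomials ρ := by
  obtain ⟨m, n, v, w, hv, hw, rfl⟩ := hy
  exact ⟨n, m, w, v, hw, hv, by simp⟩

/-- In `(v w⋆) (v' w'⋆)` the middle factor `w⋆ v'` is, up to a function, a word or the adjoint of a
word, according to the lengths. -/
theorem mul_mem_monomials {y y' : B} (hy : y ∈ monomials ρ) (hy' : y' ∈ monomials ρ) :
    y * y' ∈ monomials ρ := by
  obtain ⟨m, n, v, w, hv, hw, rfl⟩ := hy
  obtain ⟨m', n', v', w', hv', hw', rfl⟩ := hy'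
  rcases le_total n m' with h | h
  · obtain ⟨k, rfl⟩ := Nat.exists_eq_add_of_le h
    obtain ⟨v₁, v₂, h₁, h₂, rfl⟩ := hv'.split
    obtain ⟨f, hf⟩ := hw.star_mul_same h₁
    refine ⟨_, _, _, w', hv.mul (h₂.π_mul f), hw', ?_⟩
    rw [← hf]
    simp only [mul_assoc]
  · obtain ⟨k, rfl⟩ := Nat.exists_eq_add_of_le h
    obtain ⟨w₁, w₂, h₁, h₂, rfl⟩ := hw.split
    obtain ⟨f, hf⟩ := hv'.star_mul_same h₁
    refine ⟨_, _, v, _, hv, hw'.mul (h₂.π_mul f), ?_⟩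
    rw [← hf]
    simp only [star_mul, star_star, mul_assoc]

theorem adjoin_subset_span_monomials :
    (NonUnitalStarAlgebra.adjoin ℂ (Set.range ρ.π ∪ Set.range ρ.τ) : Set B) ⊆
      Submodule.span ℂ (monomials ρ) := by
  intro y hy
  refine NonUnitalStarAlgebra.adjoin_induction ℂ
    (p := fun y _ => y ∈ Submodule.span ℂ (monomials ρ))
    ?_ (fun _ _ _ _ h h' => add_mem h h') (zero_mem _) (fun y y' _ _ h h' => ?_)
    (fun c _ _ h => Submodule.smul_mem _ c h) (fun y _ h => ?_) hy
  · rintro _ (⟨f, rfl⟩ | ⟨ξ, rfl⟩)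
    · exact Submodule.subset_span (π_mem_monomials f)
    · exact Submodule.subset_span (τ_mem_monomials ξ)
  · refine Submodule.span_induction₂ (p := fun y y' _ _ => y * y' ∈ Submodule.span ℂ (monomials ρ))
      (fun y y' h h' => Submodule.subset_span (mul_mem_monomials h h')) ?_ ?_ ?_ ?_ ?_ ?_ h h'
    · intros; simp
    · intros; simp
    · intro _ _ _ _ _ _ h h'; rw [add_mul]; exact add_mem h h'
    · intro _ _ _ _ _ _ h h'; rw [mul_add]; exact add_mem h h'
    · intro c _ _ _ _ h; rw [smul_mul_assoc]; exact Submodule.smul_mem _ c h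
    · intro c _ _ _ _ h; rw [mul_smul_comm]; exact Submodule.smul_mem _ c h
  · refine Submodule.span_induction (p := fun y _ => star y ∈ Submodule.span ℂ (monomials ρ))
      (fun y h => Submodule.subset_span (star_mem_monomials h)) ?_ ?_ ?_ h
    · simp
    · intro _ _ _ _ h h'; rw [star_add]; exact add_mem h h'
    · intro c _ _ h; rw [star_smul]; exact Submodule.smul_mem _ _ h

section Dense

variable (hd : Dense (Submodule.span ℂ (monomials ρ) : Set B))
include hd

theorem π_one_mul (y : B) : ρ.π 1 * y = y := by
  have hc : IsClosed {y : B | ρ.π 1 * y = y} := isClosed_eq (by fun_prop) continuous_id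
  refine hd.induction (P := fun y => ρ.π 1 * y = y) (fun y hy => ?_) hc y
  refine Submodule.span_induction (p := fun y _ => ρ.π 1 * y = y) ?_ ?_ ?_ ?_ hy
  · rintro _ ⟨m, n, v, w, hv, -, rfl⟩
    rw [← mul_assoc, hv.one_mul]
  · simp
  · intro _ _ _ _ h h'; rw [mul_add, h, h']
  · intro c _ _ h; rw [mul_smul_comm, h]

theorem mul_π_one (y : B) : y * ρ.π 1 = y := by
  have h := congrArg star (π_one_mul hd (star y))
  rwa [star_mul, star_star, ← map_star, star_one] at h

end Dense

/-- Words of any fixed length in the members of a Parseval frame form a Parseval frame. -/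
theorem exists_word_frame {ι : Type u} [Fintype ι] {s : ι → V.Section}
    (hs : ∑ i, ρ.τ (s i) * star (ρ.τ (s i)) = ρ.π 1) (m : ℕ) :
    ∃ (κ : Type u) (_ : Fintype κ) (t : κ → B), (∀ i, IsWord ρ m (t i)) ∧
      ∑ i, t i * star (t i) = ρ.π 1 := by
  induction m with
  | zero =>
    exact ⟨PUnit, inferInstance, fun _ => ρ.π 1, fun _ => .base 1, by
      simp [← map_star, ← map_mul]⟩
  | succ m ih =>
    obtain ⟨κ, _, t, ht, ht1⟩ := ih
    refine ⟨ι × κ, inferInstance, fun p => ρ.τ (s p.1) * t p.2, fun p => .step _ (ht _), ?_⟩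
    rw [Fintype.sum_prod_type, ← hs]
    refine Finset.sum_congr rfl fun i _ => ?_
    calc ∑ j, ρ.τ (s i) * t j * star (ρ.τ (s i) * t j)
        = ρ.τ (s i) * (∑ j, t j * star (t j)) * star (ρ.τ (s i)) := by
          rw [Finset.mul_sum, Finset.sum_mul]
          exact Finset.sum_congr rfl fun j _ => by rw [star_mul]; simp only [mul_assoc]
      _ = ρ.τ (s i) * star (ρ.τ (s i)) := by rw [ht1, τ_mul_π_one]

end HermitianVectorBundle

/-! ### Elements with a matrix of continuous functions -/

section MatrixCoefficients

open scoped Matrix.Norms.L2Operator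

theorem le_of_forall_pow_two_pow_le {a b K : ℝ} (hb : 0 ≤ b)
    (h : ∀ n : ℕ, a ^ 2 ^ n ≤ K * b ^ 2 ^ n) : a ≤ b := by
  by_contra! hab
  have ha : 0 < a := hb.trans_lt hab
  have h1 : Filter.Tendsto (fun n : ℕ => K * (b / a) ^ 2 ^ n) Filter.atTop (𝓝 (K * 0)) :=
    ((tendsto_pow_atTop_nhds_zero_of_lt_one (div_nonneg hb ha.le)
      ((div_lt_one ha).2 hab)).comp (tendsto_pow_atTop_atTop_of_one_lt one_lt_two)).const_mul K
  rw [mul_zero] at h1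
  obtain ⟨n, hn⟩ := (h1.eventually_lt_const one_pos).exists
  have h2 := h n
  rw [div_pow, mul_div_assoc', div_lt_one (by positivity)] at hn
  exact absurd h2 hn.not_ge

theorem Matrix.norm_apply_le_l2_opNorm {κ : Type*} [Fintype κ] [DecidableEq κ] (M : Matrix κ κ ℂ)
    (i j : κ) : ‖M i j‖ ≤ ‖M‖ := by
  have h := M.l2_opNorm_mulVec (EuclideanSpace.single j 1)
  rw [PiLp.norm_single, norm_one, mul_one] at h
  refine le_trans ?_ h
  refine le_trans (le_of_eq ?_) (PiLp.norm_apply_le _ i)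
  simp

/-- Up to a small error the operator norm of a matrix is attained at a pair of vectors of the unit
ball. -/
theorem Matrix.exists_lt_norm_inner {κ : Type*} [Fintype κ] [DecidableEq κ] {M : Matrix κ κ ℂ}
    {r : ℝ} (hr : 0 ≤ r) (h : r < ‖M‖) :
    ∃ a b : EuclideanSpace ℂ κ, ‖a‖ ≤ 1 ∧ ‖b‖ ≤ 1 ∧
      r < ‖inner ℂ a (Matrix.toEuclideanCLM (n := κ) (𝕜 := ℂ) M b)‖ := by
  rw [Matrix.cstar_norm_def] at h
  obtain ⟨b, hb, hrb⟩ := ContinuousLinearMap.exists_lt_apply_of_lt_opNorm _ h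
  set w := Matrix.toEuclideanCLM (n := κ) (𝕜 := ℂ) M b with hw
  have hw0 : 0 < ‖w‖ := hr.trans_lt hrb
  refine ⟨((‖w‖⁻¹ : ℝ) : ℂ) • w, b, ?_, hb.le, ?_⟩
  · rw [norm_smul, Complex.norm_real, norm_inv, norm_norm, inv_mul_cancel₀ hw0.ne']
  · rw [inner_smul_left, Complex.conj_ofReal, norm_mul, Complex.norm_real, norm_inv, norm_norm,
      inner_self_eq_norm_sq_to_K]
    simpa [pow_two, ← mul_assoc, inv_mul_cancel₀ hw0.ne'] using hrb

variable {X : Type*} [TopologicalSpace X] [CompactSpace X]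
  {B : Type*} [NonUnitalCStarAlgebra B] (π : C(X, ℂ) →⋆ₙₐ[ℂ] B) {κ : Type*} [Fintype κ]
  [DecidableEq κ] (t : κ → B)

/-- `y` has the matrix `F` of continuous functions with respect to the family `t`, i.e.
`tᵢ⋆ y tⱼ = π(Fᵢⱼ)`. -/
def HasMatrix (y : B) (F : Matrix κ κ C(X, ℂ)) : Prop := ∀ i j, star (t i) * y * t j = π (F i j)

/-- The value of a matrix of functions at a point. -/
def matrixAt (F : Matrix κ κ C(X, ℂ)) (x : X) : Matrix κ κ ℂ := F.map fun f => f x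

/-- The function `x ↦ ⟨a, F(x) b⟩`. -/
def sesquilinear (F : Matrix κ κ C(X, ℂ)) (a b : EuclideanSpace ℂ κ) : C(X, ℂ) :=
  ∑ i, ∑ j, (star (a i) * b j) • F i j

theorem sesquilinear_apply (F : Matrix κ κ C(X, ℂ)) (a b : EuclideanSpace ℂ κ) (x : X) :
    sesquilinear F a b x =
      inner ℂ a (Matrix.toEuclideanCLM (n := κ) (𝕜 := ℂ) (matrixAt F x) b) := by
  simp only [sesquilinear, PiLp.inner_apply, Matrix.ofLp_toEuclideanCLM, Matrix.mulVec, dotProduct,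
    ContinuousMap.sum_apply, ContinuousMap.smul_apply, matrixAt, Matrix.map_apply]
  refine Finset.sum_congr rfl fun i _ => ?_
  rw [RCLike.inner_apply, Finset.sum_mul]
  refine Finset.sum_congr rfl fun j _ => ?_
  simp only [smul_eq_mul, RCLike.star_def]
  ring

theorem norm_sesquilinear_apply_le (F : Matrix κ κ C(X, ℂ)) (a b : EuclideanSpace ℂ κ) (x : X) :
    ‖sesquilinear F a b x‖ ≤ ‖a‖ * (‖matrixAt F x‖ * ‖b‖) := by
  rw [sesquilinear_apply]
  refine (norm_inner_le_norm _ _).trans ?_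
  gcongr
  exact ContinuousLinearMap.le_opNorm _ _

theorem matrixAt_mul (F G : Matrix κ κ C(X, ℂ)) (x : X) :
    matrixAt (F * G) x = matrixAt F x * matrixAt G x := by
  ext i j
  simp [matrixAt, Matrix.mul_apply]

theorem matrixAt_conjTranspose (F : Matrix κ κ C(X, ℂ)) (x : X) :
    matrixAt F.conjTranspose x = (matrixAt F x).conjTranspose := by
  ext i j
  simp [matrixAt]

variable {π t} (h1 : ∀ y, y * (∑ i, t i * star (t i)) = y)
include h1

theorem HasMatrix.mul {y z : B} {F G : Matrix κ κ C(X, ℂ)} (hy : HasMatrix π t y F)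
    (hz : HasMatrix π t z G) : HasMatrix π t (y * z) (F * G) := fun i j => by
  rw [Matrix.mul_apply, map_sum]
  simp only [map_mul, ← hy i, ← hz _ j]
  calc star (t i) * (y * z) * t j = star (t i) * (y * (∑ k, t k * star (t k))) * z * t j := by
        rw [h1]; simp only [mul_assoc]
    _ = _ := by
        simp only [Finset.mul_sum, Finset.sum_mul, mul_assoc]

omit h1 in
theorem HasMatrix.adjoint {y : B} {F : Matrix κ κ C(X, ℂ)} (hy : HasMatrix π t y F) :
    HasMatrix π t (star y) F.conjTranspose := fun i j => by
  rw [Matrix.conjTranspose_apply, map_star, ← hy, star_mul, star_mul, star_star, mul_assoc]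

variable (h1' : ∀ y, (∑ i, t i * star (t i)) * y = y)
include h1'

theorem HasMatrix.norm_pow_le {y : B} {F : Matrix κ κ C(X, ℂ)} (hy : HasMatrix π t y F) {R : ℝ}
    (hR : ∀ x, ‖matrixAt F x‖ ≤ R) (hsa : IsSelfAdjoint y) (hR0 : 0 ≤ R) (n : ℕ) :
    ‖y‖ ^ 2 ^ n ≤ (∑ i, ∑ j, ‖t i‖ * ‖t j‖) * R ^ 2 ^ n := by
  induction n generalizing y F R with
  | zero =>
    have hyt : y = ∑ i, ∑ j, t i * π (F i j) * star (t j) := by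
      conv_lhs => rw [← h1 y, ← h1' y]
      simp only [Finset.mul_sum, Finset.sum_mul, ← hy _ _, mul_assoc]
      exact Finset.sum_comm
    rw [pow_zero, pow_one, pow_one]
    conv_lhs => rw [hyt]
    rw [Finset.sum_mul]
    refine (norm_sum_le _ _).trans (Finset.sum_le_sum fun i _ => ?_)
    rw [Finset.sum_mul]
    refine (norm_sum_le _ _).trans (Finset.sum_le_sum fun j _ => ?_)
    have hF : ‖π (F i j)‖ ≤ R := by
      refine (NonUnitalStarAlgHom.norm_apply_le π _).trans ?_
      refine (ContinuousMap.norm_le _ hR0).2 fun x => ?_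
      exact ((matrixAt F x).norm_apply_le_l2_opNorm i j).trans (hR x)
    calc ‖t i * π (F i j) * star (t j)‖ ≤ ‖t i‖ * ‖π (F i j)‖ * ‖star (t j)‖ :=
          (norm_mul_le _ _).trans (by gcongr; exact norm_mul_le _ _)
      _ ≤ ‖t i‖ * R * ‖t j‖ := by rw [norm_star]; gcongr
      _ = ‖t i‖ * ‖t j‖ * R := by ring
  | succ n ih =>
    have h := ih (hy.mul h1 hy) (R := R ^ 2) (fun x => ?_) (by
      rw [IsSelfAdjoint, star_mul, hsa.star_eq]) (by positivity)
    · rwa [hsa.norm_mul_self, ← pow_mul, ← pow_mul, ← pow_succ'] at h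
    · rw [matrixAt_mul, pow_two]
      exact (norm_mul_le _ _).trans (mul_le_mul (hR x) (hR x) (norm_nonneg _) hR0)

/-- The norm is bounded by the pointwise norm of the matrix.  The crude bound by a multiple of it
which depends on the size of the matrix is improved by passing to high powers. -/
theorem HasMatrix.norm_le {y : B} {F : Matrix κ κ C(X, ℂ)} (hy : HasMatrix π t y F) {R : ℝ}
    (hR0 : 0 ≤ R) (hR : ∀ x, ‖matrixAt F x‖ ≤ R) : ‖y‖ ≤ R := by
  have h : ‖star y * y‖ ≤ R ^ 2 := by
    refine le_of_forall_pow_two_pow_le (by positivity) fun n =>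
      (hy.adjoint.mul h1 hy).norm_pow_le h1 h1' (fun x => ?_) (IsSelfAdjoint.star_mul_self y)
        (by positivity) n
    rw [matrixAt_mul, matrixAt_conjTranspose, Matrix.l2_opNorm_conjTranspose_mul_self, pow_two]
    exact mul_le_mul (hR x) (hR x) (norm_nonneg _) hR0
  rw [CStarRing.norm_star_mul_self, ← pow_two] at h
  exact (pow_le_pow_iff_left₀ (norm_nonneg _) hR0 two_ne_zero).mp h

omit h1 h1' in
theorem HasMatrix.sesquilinear {y : B} {F : Matrix κ κ C(X, ℂ)} (hy : HasMatrix π t y F)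
    (a b : EuclideanSpace ℂ κ) :
    star (∑ i, a i • t i) * y * (∑ i, b i • t i) = π (sesquilinear F a b) := by
  simp only [_root_.sesquilinear, map_sum, map_smul, ← hy _ _]
  simp only [star_sum, star_smul, Finset.sum_mul, Finset.mul_sum, smul_mul_assoc, mul_smul_comm,
    Finset.smul_sum, smul_smul]
  rw [Finset.sum_comm]
  exact Finset.sum_congr rfl fun i _ => Finset.sum_congr rfl fun j _ => by rw [mul_comm (b j)]

/-- The matrix of the unit is a projection, so unit vectors give contractions. -/
theorem norm_sum_smul_le_one (hπ : Function.Injective π) {P : Matrix κ κ C(X, ℂ)}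
    (hP : HasMatrix π t (∑ i, t i * star (t i)) P) {b : EuclideanSpace ℂ κ} (hb : ‖b‖ ≤ 1) :
    ‖∑ i, b i • t i‖ ≤ 1 := by
  have hPP : P.conjTranspose * P = P := by
    have h := hP.adjoint.mul h1 hP
    rw [h1, star_sum] at h
    simp only [star_mul, star_star] at h
    ext1 i j
    exact hπ ((h i j).symm.trans (hP i j))
  have hPx : ∀ x, ‖matrixAt P x‖ ≤ 1 := fun x => by
    have h : ‖matrixAt P x‖ = ‖matrixAt P x‖ * ‖matrixAt P x‖ := by
      conv_lhs => rw [← hPP, matrixAt_mul, matrixAt_conjTranspose,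
        Matrix.l2_opNorm_conjTranspose_mul_self]
    by_contra! hlt
    nlinarith
  have h : ‖∑ i, b i • t i‖ ^ 2 ≤ 1 := by
    rw [pow_two, ← CStarRing.norm_star_mul_self]
    have h2 := hP.sesquilinear b b
    rw [mul_assoc, h1'] at h2
    rw [h2]
    refine (NonUnitalStarAlgHom.norm_apply_le π _).trans ?_
    refine (ContinuousMap.norm_le _ zero_le_one).2 fun x => ?_
    refine (norm_sesquilinear_apply_le P b b x).trans ?_
    exact mul_le_one₀ hb (by positivity) (mul_le_one₀ (hPx x) (norm_nonneg _) hb)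
  exact (sq_le_one_iff₀ (norm_nonneg _)).1 h

end MatrixCoefficients

/-! ### Gauge actions -/

section Gauge

open scoped Real

variable {B : Type*} [NonUnitalCStarAlgebra B]

/-- Summing the gauge translates over the `n`-th roots of unity annihilates the terms of degree `k`
with `0 < |k| < n`. -/
theorem sum_gauge_eq_nsmul {γ : Circle → B →⋆ₙₐ[ℂ] B} {d : ℤ →₀ B}
    (hd : ∀ k z, γ z (d k) = ((z : ℂ) ^ k) • d k) {n : ℕ} (hn : ∀ k ∈ d.support, k.natAbs < n) :
    ∑ j ∈ Finset.range n, γ (Circle.exp (2 * π * j / n)) (d.sum fun _ y => y) = (n : ℂ) • d 0 := by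
  rcases Nat.eq_zero_or_pos n with rfl | hn0
  · simp
  set ζ : ℂ := Complex.exp (2 * π * Complex.I / n) with hζdef
  have hζ : IsPrimitiveRoot ζ n := Complex.isPrimitiveRoot_exp n hn0.ne'
  have hz : ∀ j : ℕ, ((Circle.exp (2 * π * j / n) : Circle) : ℂ) = ζ ^ j := fun j => by
    rw [Circle.coe_exp, hζdef, ← Complex.exp_nat_mul]
    congr 1
    push_cast
    ring
  have h1 : ∀ k ∈ d.support, ∑ j ∈ Finset.range n, (ζ ^ j) ^ k = if k = 0 then (n : ℂ) else 0 :=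
    fun k hk => by
      by_cases h0 : k = 0
      · simp [h0]
      have h2 : ∀ j : ℕ, (ζ ^ j) ^ k = (ζ ^ k) ^ j := fun j => by
        rw [← zpow_natCast, ← zpow_natCast, zpow_comm]
      have hne : ζ ^ k ≠ 1 := fun h => by
        rw [hζ.zpow_eq_one_iff_dvd] at h
        have h3 := Int.natAbs_dvd_natAbs.2 h
        rw [Int.natAbs_natCast] at h3
        exact absurd (Nat.le_of_dvd (Int.natAbs_pos.2 h0) h3) (hn k hk).not_ge
      have hpow : (ζ ^ k) ^ n = 1 := by rw [← h2, hζ.pow_eq_one, one_zpow]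
      rw [if_neg h0, Finset.sum_congr rfl fun j _ => h2 j, geom_sum_eq hne, hpow, sub_self,
        zero_div]
  simp only [Finsupp.sum, map_sum, hd, hz]
  rw [Finset.sum_comm]
  simp only [← Finset.sum_smul]
  rw [Finset.sum_congr rfl fun k hk => by rw [h1 k hk]]
  simp only [ite_smul, zero_smul, Finset.sum_ite_eq']
  by_cases h0 : (0 : ℤ) ∈ d.support
  · rw [if_pos h0]
  · rw [if_neg h0, Finsupp.notMem_support_iff.1 h0, smul_zero]

/-- Faithfulness of the expectation onto the fixed point algebra of a gauge action, in a form which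
refers only to finite sums of homogeneous elements: if `c = b⋆ b` is nonzero then the degree zero
parts of all good approximations of `c` have norms bounded below, uniformly. -/
theorem exists_lt_norm_degree_zero (γ : Circle → B →⋆ₙₐ[ℂ] B)
    (hdense : ∀ c : B, ∀ ε > 0, ∃ d : ℤ →₀ B, (∀ k z, γ z (d k) = ((z : ℂ) ^ k) • d k) ∧
      ‖c - d.sum fun _ y => y‖ < ε) {b : B} (hb : b ≠ 0) :
    ∃ ε Δ : ℝ, 0 < ε ∧ ε < Δ ∧ ∀ d : ℤ →₀ B, (∀ k z, γ z (d k) = ((z : ℂ) ^ k) • d k) →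
      ‖star b * b - d.sum fun _ y => y‖ ≤ ε → Δ < ‖d 0‖ := by
  let _ : PartialOrder B := CStarAlgebra.spectralOrder B
  let _ : StarOrderedRing B := CStarAlgebra.spectralOrderedRing B
  set c := star b * b with hc
  have hγn : ∀ z y, ‖γ z y‖ ≤ ‖y‖ := fun z y => NonUnitalStarAlgHom.norm_apply_le (γ z) y
  have hγc : ∀ z, 0 ≤ γ z c := fun z => by
    rw [hc, map_mul, map_star]
    exact star_mul_self_nonneg _
  have hκ : 0 < ‖c‖ := by
    rw [norm_pos_iff, hc]
    exact (CStarRing.star_mul_self_ne_zero_iff _).2 hb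
  set κ := ‖c‖ with hκdef
  -- for `t` in a neighbourhood of zero `γ` moves `c` by less than half its norm
  obtain ⟨θ, hθ, hθc⟩ : ∃ θ > 0, ∀ t : ℝ, |t| < θ → ‖γ (Circle.exp t) c - c‖ ≤ κ / 2 := by
    obtain ⟨d, hd, hdc⟩ := hdense c (κ / 8) (by positivity)
    set y := d.sum fun _ y => y with hy
    have hcont : Continuous fun t : ℝ => ∑ k ∈ d.support, ((Circle.exp t : Circle) : ℂ) ^ k • d k :=
      continuous_finsetSum _ fun k _ => by
        refine Continuous.smul (Continuous.zpow₀ (by fun_prop) k fun t => ?_) continuous_const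
        exact Or.inl (Circle.coe_ne_zero _)
    have hγy : ∀ t : ℝ, γ (Circle.exp t) y =
        ∑ k ∈ d.support, ((Circle.exp t : Circle) : ℂ) ^ k • d k := fun t => by
      simp only [hy, Finsupp.sum, map_sum, hd]
    have h0 : ∑ k ∈ d.support, ((Circle.exp 0 : Circle) : ℂ) ^ k • d k = y := by
      simp [hy, Finsupp.sum]
    obtain ⟨θ, hθ, h⟩ := Metric.continuous_iff.1 hcont 0 (κ / 4) (by positivity)
    refine ⟨θ, hθ, fun t ht => ?_⟩
    have h1 := h t (by simpa [Real.dist_eq] using ht)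
    rw [dist_eq_norm, h0, ← hγy] at h1
    have h2 : γ (Circle.exp t) c - c =
        γ (Circle.exp t) (c - y) + (γ (Circle.exp t) y - y) - (c - y) := by
      rw [map_sub]; abel
    rw [h2]
    have h3 := hγn (Circle.exp t) (c - y)
    have h4 := norm_sub_le (γ (Circle.exp t) (c - y) + (γ (Circle.exp t) y - y)) (c - y)
    have h5 := norm_add_le (γ (Circle.exp t) (c - y)) (γ (Circle.exp t) y - y)
    linarith
  obtain ⟨L, hL⟩ := exists_nat_gt (2 * π / θ)
  have hL0 : (0 : ℝ) < L := lt_of_le_of_lt (by positivity) hL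
  rw [div_lt_iff₀ hθ] at hL
  refine ⟨κ / (8 * L), κ / (4 * L), by positivity, ?_, fun d hd hdc => ?_⟩
  · gcongr; norm_num
  -- the first `N` of the `L N` roots of unity lie in the neighbourhood
  set N : ℕ := ∑ k ∈ d.support, k.natAbs + 1 with hN
  have hN0 : (0 : ℝ) < N := by rw [hN]; positivity
  have hLnat : 1 ≤ L := by exact_mod_cast hL0
  have hlt : ∀ k ∈ d.support, k.natAbs < L * N := fun k hk => by
    have h1 : k.natAbs ≤ ∑ k ∈ d.support, k.natAbs :=
      Finset.single_le_sum (f := fun k : ℤ => k.natAbs) (fun _ _ => Nat.zero_le _) hk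
    calc k.natAbs < N := by omega
      _ ≤ L * N := Nat.le_mul_of_pos_left N hLnat
  have hsum := sum_gauge_eq_nsmul hd hlt
  set g : ℕ → B → B := fun j => γ (Circle.exp (2 * π * j / (L * N : ℕ))) with hg
  have hlow : N * κ - N * (κ / 2) ≤ ‖∑ j ∈ Finset.range N, g j c‖ := by
    have h1 : ‖∑ j ∈ Finset.range N, (g j c - c)‖ ≤ N * (κ / 2) := by
      refine (norm_sum_le_of_le _ fun j hj => hθc _ ?_).trans_eq (by simp)
      have hj' : (j : ℝ) < N := by exact_mod_cast Finset.mem_range.1 hj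
      rw [abs_of_nonneg (by positivity), Nat.cast_mul, div_lt_iff₀ (by positivity)]
      calc 2 * π * j ≤ 2 * π * N := by gcongr
        _ < (L * θ) * N := by gcongr
        _ = θ * (L * N) := by ring
    have h2 : (N : ℂ) • c = ∑ j ∈ Finset.range N, g j c - ∑ j ∈ Finset.range N, (g j c - c) := by
      rw [Finset.sum_sub_distrib, sub_sub_cancel, Finset.sum_const, Finset.card_range,
        Nat.cast_smul_eq_nsmul]
    have h3 := norm_sub_le (∑ j ∈ Finset.range N, g j c) (∑ j ∈ Finset.range N, (g j c - c))
    rw [← h2, norm_smul, Complex.norm_natCast] at h3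
    linarith
  have hmono : ‖∑ j ∈ Finset.range N, g j c‖ ≤ ‖∑ j ∈ Finset.range (L * N), g j c‖ :=
    CStarAlgebra.norm_le_norm_of_nonneg_of_le (Finset.sum_nonneg fun j _ => hγc _)
      (Finset.sum_le_sum_of_subset_of_nonneg
        (Finset.range_subset_range.2 (Nat.le_mul_of_pos_left N hLnat)) fun j _ _ => hγc _)
  have hup : ‖∑ j ∈ Finset.range (L * N), g j c‖ ≤ L * N * (κ / (8 * L)) + L * N * ‖d 0‖ := by
    have h1 : ∑ j ∈ Finset.range (L * N), g j c =
        ∑ j ∈ Finset.range (L * N), g j (c - d.sum fun _ y => y) + ((L * N : ℕ) : ℂ) • d 0 := by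
      rw [← hsum, ← Finset.sum_add_distrib]
      refine Finset.sum_congr rfl fun j _ => ?_
      simp only [hg]
      rw [← map_add, sub_add_cancel]
    rw [h1]
    refine (norm_add_le _ _).trans (add_le_add ?_ ?_)
    · refine (norm_sum_le_of_le _ fun j _ => (hγn _ _).trans hdc).trans_eq ?_
      simp
    · rw [norm_smul, Complex.norm_natCast, Nat.cast_mul]
  have h1 : L * N * (κ / (8 * L)) = N * κ / 8 := by field_simp
  rw [h1] at hup
  have h2 : N * (κ / 4) < N * (L * ‖d 0‖) := by
    have : 0 < N * κ := by positivity
    linarith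
  have h3 := lt_of_mul_lt_mul_left h2 hN0.le
  rw [div_lt_iff₀ (by positivity)]
  linarith

end Gauge

namespace HermitianVectorBundle

variable {X : Type u} [TopologicalSpace X] [CompactSpace X] {V : HermitianVectorBundle.{u, v} X}
  {α : X ≃ₜ X} {B : Type*} [NonUnitalCStarAlgebra B]
  {ρ : (V.sectionCorrespondence α).Representation B}

theorem IsWord.gauge {γ : B →⋆ₙₐ[ℂ] B} {z : ℂ} (hγπ : ∀ f, γ (ρ.π f) = ρ.π f)
    (hγτ : ∀ ξ, γ (ρ.τ ξ) = z • ρ.τ ξ) {n : ℕ} {w : B} (h : IsWord ρ n w) :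
    γ w = z ^ n • w := by
  induction h with
  | base f => rw [hγπ, pow_zero, one_smul]
  | step ξ h ih => rw [map_mul, hγτ, ih, smul_mul_smul_comm, pow_succ']

/-- The elements of the span of the monomials are finite sums of homogeneous elements, whose degree
zero part is compressed to functions by all sufficiently long words. -/
theorem exists_homogeneous_decomposition {γ : Circle → B →⋆ₙₐ[ℂ] B}
    (hγπ : ∀ z f, γ z (ρ.π f) = ρ.π f) (hγτ : ∀ z ξ, γ z (ρ.τ ξ) = (z : ℂ) • ρ.τ ξ) {c : B}
    (hc : c ∈ Submodule.span ℂ (monomials ρ)) :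
    ∃ d : ℤ →₀ B, (d.sum fun _ y => y) = c ∧ (∀ k, HasDegree ρ k (d k)) ∧
      (∀ k z, γ z (d k) = ((z : ℂ) ^ k) • d k) ∧
      ∃ m₀, ∀ m ≥ m₀, ∀ w w', IsWord ρ m w → IsWord ρ m w' →
        ∃ f, star w * d 0 * w' = ρ.π f := by
  induction hc using Submodule.span_induction with
  | mem c hc =>
    obtain ⟨m, n, v, w, hv, hw, rfl⟩ := hc
    have hdeg : HasDegree ρ ((m : ℤ) - n) (v * star w) := hv.hasDegree.mul hw.hasDegree.star
    refine ⟨Finsupp.single ((m : ℤ) - n) (v * star w), Finsupp.sum_single_index rfl, fun k => ?_, fun k z => ?_, n,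
      fun l hl a b ha hb => ?_⟩
    · by_cases hk : (m : ℤ) - n = k
      · subst hk
        rwa [Finsupp.single_eq_same]
      · rw [Finsupp.single_eq_of_ne (Ne.symm hk)]
        exact .zero
    · by_cases hk : (m : ℤ) - n = k
      · subst hk
        rw [Finsupp.single_eq_same, map_mul, map_star, hv.gauge (hγπ z) (hγτ z),
          hw.gauge (hγπ z) (hγτ z), star_smul, smul_mul_smul_comm, zpow_sub₀ (Circle.coe_ne_zero z),
          zpow_natCast, zpow_natCast, div_eq_mul_inv, ← inv_pow, ← Circle.coe_inv,
          Circle.coe_inv_eq_conj, star_pow]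
        rfl
      · rw [Finsupp.single_eq_of_ne (Ne.symm hk), map_zero, smul_zero]
    · by_cases hk : (m : ℤ) - n = 0
      · obtain rfl : m = n := by omega
        rw [hk, Finsupp.single_eq_same]
        exact IsWord.compress_monomial hv hw hl ha hb
      · rw [Finsupp.single_eq_of_ne (Ne.symm hk)]
        exact ⟨0, by simp⟩
  | zero =>
    exact ⟨0, by simp, fun k => .zero, fun k z => by simp, 0, fun m _ w w' _ _ => ⟨0, by simp⟩⟩
  | add c c' _ _ ih ih' =>
    obtain ⟨d, rfl, h1, h2, m, h3⟩ := ih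
    obtain ⟨d', rfl, h1', h2', m', h3'⟩ := ih'
    refine ⟨d + d', Finsupp.sum_add_index' (fun _ => rfl) (fun _ _ _ => rfl),
      fun k => (h1 k).add (h1' k), fun k z => ?_, max m m', fun l hl w w' hw hw' => ?_⟩
    · rw [Finsupp.add_apply, map_add, h2, h2', smul_add]
    · obtain ⟨f, hf⟩ := h3 l (le_of_max_le_left hl) w w' hw hw'
      obtain ⟨f', hf'⟩ := h3' l (le_of_max_le_right hl) w w' hw hw'
      exact ⟨f + f', by rw [Finsupp.add_apply, mul_add, add_mul, hf, hf', map_add]⟩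
  | smul a c _ ih =>
    obtain ⟨d, rfl, h1, h2, m, h3⟩ := ih
    refine ⟨a • d, ?_, fun k => (h1 k).smul a, fun k z => ?_, m, fun l hl w w' hw hw' => ?_⟩
    · rw [Finsupp.sum_smul_index' (fun _ => rfl), Finsupp.smul_sum]
    · rw [Finsupp.smul_apply, map_smul, h2, smul_comm]
    · obtain ⟨f, hf⟩ := h3 l hl w w' hw hw'
      exact ⟨a • f, by rw [Finsupp.smul_apply, mul_smul_comm, smul_mul_assoc, hf, map_smul]⟩

end HermitianVectorBundle

/-! ### Ideals -/

/-- An element of a closed ideal which is closer to `π f` than `|f x|` yields an element `π g` of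
the ideal with `g x ≠ 0`. -/
theorem exists_π_mem_of_norm_sub_lt {X : Type*} [TopologicalSpace X] [CompactSpace X] {B : Type*}
    [NonUnitalCStarAlgebra B] (π : C(X, ℂ) →⋆ₙₐ[ℂ] B) {I : TwoSidedIdeal B}
    (hI : IsClosed (I : Set B)) {y : B} (hy : y ∈ I) {f : C(X, ℂ)} {x : X}
    (hyf : ‖y - π f‖ < ‖f x‖) : ∃ g : C(X, ℂ), g x ≠ 0 ∧ π g ∈ I := by
  obtain ⟨δ, hδ1, hδ2⟩ := exists_between hyf
  have hδ : 0 < δ := (norm_nonneg _).trans_lt hδ1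
  -- `q` is an inverse of `f` on the set `|f| ≥ δ`, which supports `g`
  let g : C(X, ℂ) := ⟨fun x => ((max (‖f x‖ - δ) 0 : ℝ) : ℂ), by fun_prop⟩
  let q : C(X, ℂ) := ⟨fun x => star (f x) * ((((max ‖f x‖ δ) ^ 2)⁻¹ : ℝ) : ℂ), by
    have h : ∀ x, (max ‖f x‖ δ) ^ 2 ≠ 0 := fun x => by positivity
    have h2 : Continuous fun x => ((max ‖f x‖ δ) ^ 2)⁻¹ := Continuous.inv₀ (by fun_prop) h
    fun_prop⟩
  have hqfg : q * f * g = g := by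
    ext x
    change star (f x) * ((((max ‖f x‖ δ) ^ 2)⁻¹ : ℝ) : ℂ) * f x *
      ((max (‖f x‖ - δ) 0 : ℝ) : ℂ) = ((max (‖f x‖ - δ) 0 : ℝ) : ℂ)
    rcases le_total ‖f x‖ δ with h | h
    · rw [max_eq_right (sub_nonpos.2 h)]
      simp
    · have h1 : star (f x) * f x = ((‖f x‖ ^ 2 : ℝ) : ℂ) := by
        rw [mul_comm]
        simpa using Complex.mul_conj' (f x)
      have h2 : ‖f x‖ ^ 2 ≠ 0 := by
        have := hδ.trans_le h
        positivity
      rw [max_eq_left h, mul_right_comm (star (f x)), h1, ← Complex.ofReal_mul, mul_inv_cancel₀ h2]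
      simp
  have hqn : ‖q‖ ≤ δ⁻¹ := by
    refine (ContinuousMap.norm_le _ (by positivity)).2 fun x => ?_
    change ‖star (f x) * ((((max ‖f x‖ δ) ^ 2)⁻¹ : ℝ) : ℂ)‖ ≤ _
    have hm : 0 < max ‖f x‖ δ := hδ.trans_le (le_max_right _ _)
    rw [norm_mul, norm_star, Complex.norm_real, Real.norm_of_nonneg (by positivity)]
    calc ‖f x‖ * ((max ‖f x‖ δ) ^ 2)⁻¹ ≤ max ‖f x‖ δ * ((max ‖f x‖ δ) ^ 2)⁻¹ := by
          gcongr
          exact le_max_left _ _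
      _ = (max ‖f x‖ δ)⁻¹ := by field_simp
      _ ≤ δ⁻¹ := by
          gcongr
          exact le_max_right _ _
  refine ⟨g, ?_, ?_⟩
  · change ((max (‖f x‖ - δ) 0 : ℝ) : ℂ) ≠ 0
    rw [max_eq_left (by linarith)]
    exact_mod_cast (sub_pos.2 hδ2).ne'
  set c : B := π (q * f) - π q * y with hc
  have hcn : ‖c‖ < 1 := by
    have h1 : c = -(π q * (y - π f)) := by
      rw [hc, map_mul, mul_sub]; abel
    rw [h1, norm_neg]
    calc ‖π q * (y - π f)‖ ≤ ‖π q‖ * ‖y - π f‖ := norm_mul_le _ _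
      _ ≤ δ⁻¹ * ‖y - π f‖ := by
          gcongr
          exact (NonUnitalStarAlgHom.norm_apply_le π q).trans hqn
      _ < 1 := by rwa [inv_mul_lt_iff₀ hδ, mul_one]
  have hcg : π g - c * π g ∈ I := by
    have h1 : π g - c * π g = π q * y * π g := by
      rw [hc, sub_mul, ← map_mul, hqfg, sub_sub_cancel]
    rw [h1]
    exact I.mul_mem_right _ _ (I.mul_mem_left _ _ hy)
  -- modulo the ideal, `π g` equals `cⁿ π g` for every `n`
  have hn : ∀ n : ℕ, ∃ w, ‖w‖ ≤ ‖c‖ ^ n * ‖π g‖ ∧ π g - w ∈ I := fun n => by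
    induction n with
    | zero => exact ⟨π g, by simp, by simp⟩
    | succ n ih =>
      obtain ⟨w, hw, hwI⟩ := ih
      refine ⟨c * w, ?_, ?_⟩
      · rw [pow_succ', mul_assoc]
        exact (norm_mul_le _ _).trans (by gcongr)
      · have h1 : π g - c * w = (π g - c * π g) + c * (π g - w) := by
          rw [mul_sub]; abel
        rw [h1]
        exact I.add_mem hcg (I.mul_mem_left _ _ hwI)
  choose w hw hwI using hn
  have hw0 : Filter.Tendsto w Filter.atTop (𝓝 0) := by
    refine squeeze_zero_norm hw ?_
    simpa using (tendsto_pow_atTop_nhds_zero_of_lt_one (norm_nonneg c) hcn).mul_const ‖π g‖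
  have hlim : Filter.Tendsto (fun n => π g - w n) Filter.atTop (𝓝 (π g)) := by
    simpa using tendsto_const_nhds.sub hw0
  exact hI.mem_of_tendsto hlim (Filter.Eventually.of_forall hwI)

namespace HermitianVectorBundle

section Aperiodic

variable {X : Type u} [TopologicalSpace X]

/-- A minimal homeomorphism of an infinite space has no periodic points, as a periodic orbit would
be a finite invariant closed set. -/
theorem zpow_apply_ne_of_isMinimal [T1Space X] [Infinite X] {α : X ≃ₜ X}
    (hα : IsMinimalHomeomorph α) {k : ℤ} (hk : k ≠ 0) (x : X) : (α ^ k) x ≠ x := by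
  intro hx
  have hmul : ∀ j l : ℤ, (α ^ (j + l)) x = (α ^ j) ((α ^ l) x) := fun j l => by
    rw [zpow_add]; rfl
  have hper : ∀ q : ℤ, (α ^ (k * q)) x = x := fun q => by
    induction q using Int.induction_on with
    | zero => simp
    | succ q ih => rw [mul_add, mul_one, hmul, hx, ih]
    | pred q ih =>
      have h := hmul (k * (-q - 1)) k
      rwa [hx, ← mul_add_one, sub_add_cancel, ih, eq_comm] at h
  let O : Set X := Set.range fun j : ℤ => (α ^ j) x
  have hO : O.Finite := by
    refine ((Set.finite_Ico (0 : ℤ) |k|).image fun j => (α ^ j) x).subset ?_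
    rintro _ ⟨j, rfl⟩
    refine ⟨j % k, ⟨Int.emod_nonneg j hk, Int.emod_lt_abs j hk⟩, ?_⟩
    change (α ^ (j % k)) x = (α ^ j) x
    conv_rhs => rw [← Int.emod_add_mul_ediv j k, hmul, hper]
  have hαO : α '' O ⊆ O := by
    rintro _ ⟨_, ⟨j, rfl⟩, rfl⟩
    refine ⟨1 + j, ?_⟩
    change (α ^ (1 + j)) x = α ((α ^ j) x)
    rw [hmul, zpow_one]
  rcases hα O hO.isClosed hαO with h | h
  · exact Set.eq_empty_iff_forall_notMem.1 h x ⟨0, by simp⟩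
  · exact Set.infinite_univ (h ▸ hO)

/-- Near a point which is not periodic there are functions which are orthogonal to finitely many of
their translates. -/
theorem exists_bump_mul_pullback_eq_zero [CompactSpace X] [T2Space X] {α : X ≃ₜ X} {x : X}
    (hx : ∀ k : ℤ, k ≠ 0 → (α ^ k) x ≠ x) (S : Finset ℤ) :
    ∃ h : C(X, ℂ), h x = 1 ∧ ‖h‖ ≤ 1 ∧ ∀ k ∈ S, k ≠ 0 → pullback α k h * h = 0 := by
  have hU : ∀ k : ℤ, ∃ U : Set X, IsOpen U ∧ x ∈ U ∧ (k ≠ 0 → ∀ y ∈ U, (α ^ k) y ∉ U) :=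
    fun k => by
      by_cases hk : k = 0
      · exact ⟨Set.univ, isOpen_univ, trivial, fun h => absurd hk h⟩
      · obtain ⟨U, W, hU, hW, hxU, hxW, hUW⟩ := t2_separation (hx k hk).symm
        refine ⟨U ∩ (α ^ k) ⁻¹' W, hU.inter (hW.preimage (α ^ k).continuous), ⟨hxU, hxW⟩,
          fun _ y hy hy' => ?_⟩
        exact Set.disjoint_left.1 hUW hy'.1 hy.2
  choose U hUo hxU hUk using hU
  have hopen : IsOpen (⋂ k ∈ S, U k) := isOpen_biInter_finset fun k _ => hUo k
  obtain ⟨f, hf0, hf1, hf⟩ := exists_continuous_zero_one_of_isClosed hopen.isClosed_compl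
    (isClosed_singleton (x := x)) (by
      rw [Set.disjoint_singleton_right]
      exact fun h => h (Set.mem_iInter₂.2 fun k _ => hxU k))
  refine ⟨⟨fun y => ((f y : ℝ) : ℂ), by fun_prop⟩, ?_, ?_, fun k hk hk0 => ?_⟩
  · have := hf1 rfl
    simp only [Pi.one_apply] at this
    simp [this]
  · refine (ContinuousMap.norm_le _ zero_le_one).2 fun y => ?_
    change ‖((f y : ℝ) : ℂ)‖ ≤ 1
    rw [Complex.norm_real, Real.norm_of_nonneg (hf y).1]
    exact (hf y).2
  · ext y
    change ((f ((α ^ k) y) : ℝ) : ℂ) * ((f y : ℝ) : ℂ) = 0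
    by_cases hy : y ∈ ⋂ k ∈ S, U k
    · have h : (α ^ k) y ∈ (⋂ k ∈ S, U k)ᶜ := fun h =>
        hUk k hk0 y (Set.mem_iInter₂.1 hy k hk) (Set.mem_iInter₂.1 h k hk)
      rw [hf0 h]
      simp
    · rw [hf0 hy]
      simp

end Aperiodic

variable {X : Type u} [TopologicalSpace X] [CompactSpace X] [T2Space X]
  {V : HermitianVectorBundle.{u, v} X} {α : X ≃ₜ X} {B : Type*} [NonUnitalCStarAlgebra B]
  {ρ : (V.sectionCorrespondence α).Representation B}

open scoped Matrix.Norms.L2Operator in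
/-- If `α` has no periodic points then every nonzero closed ideal contains some `π g` with `g ≠ 0`.
Words in the members of a frame compress the degree zero part of an approximation of an element of
the ideal to a function, and a bump function at a point removes the other degrees. -/
theorem exists_π_mem_of_ne_zero {ι : Type u} [Fintype ι] {s : ι → V.Section}
    (hs : ∑ i, ρ.τ (s i) * star (ρ.τ (s i)) = ρ.π 1) (hπ : Function.Injective ρ.π)
    (hd : Dense (Submodule.span ℂ (monomials ρ) : Set B)) (γ : Circle → B →⋆ₙₐ[ℂ] B)
    (hγπ : ∀ z f, γ z (ρ.π f) = ρ.π f) (hγτ : ∀ z ξ, γ z (ρ.τ ξ) = (z : ℂ) • ρ.τ ξ)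
    (hα : ∀ (x : X) (k : ℤ), k ≠ 0 → (α ^ k) x ≠ x) {I : TwoSidedIdeal B}
    (hI : IsClosed (I : Set B)) {b : B} (hbI : b ∈ I) (hb : b ≠ 0) :
    ∃ (x : X) (g : C(X, ℂ)), g x ≠ 0 ∧ ρ.π g ∈ I := by
  classical
  have happrox : ∀ c : B, ∀ ε > 0, ∃ c' ∈ Submodule.span ℂ (monomials ρ), ‖c - c'‖ < ε :=
    fun c ε hε => by
      obtain ⟨c', hc', h⟩ := Metric.dense_iff.1 hd c ε hε
      exact ⟨c', h, by rwa [← dist_eq_norm, dist_comm]⟩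
  obtain ⟨ε, Δ, hε, hεΔ, hΔ⟩ := exists_lt_norm_degree_zero γ (fun c ε hε => by
    obtain ⟨c', hc', h⟩ := happrox c ε hε
    obtain ⟨d, rfl, -, hd, -⟩ := exists_homogeneous_decomposition hγπ hγτ hc'
    exact ⟨d, hd, h⟩) hb
  obtain ⟨c', hc', hcc'⟩ := happrox (star b * b) ε hε
  obtain ⟨d, rfl, hdeg, hdγ, m, hm⟩ := exists_homogeneous_decomposition hγπ hγτ hc'
  have hd0 := hΔ d hdγ hcc'.le
  obtain ⟨κ, _, t, ht, ht1⟩ := exists_word_frame hs m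
  have h1 : ∀ y, y * (∑ i, t i * star (t i)) = y := fun y => by rw [ht1, mul_π_one hd]
  have h1' : ∀ y, (∑ i, t i * star (t i)) * y = y := fun y => by rw [ht1, π_one_mul hd]
  choose F hF using fun i j => hm m le_rfl _ _ (ht i) (ht j)
  choose P hP using fun i j => (ht i).star_mul_same (ht j)
  have hFm : HasMatrix ρ.π t (d 0) (Matrix.of F) := hF
  have hPm : HasMatrix ρ.π t (∑ i, t i * star (t i)) (Matrix.of P) := fun i j => by
    rw [h1]
    exact hP i j
  -- a point and vectors at which the matrix of the degree zero part is large
  obtain ⟨x, hx⟩ : ∃ x, Δ < ‖matrixAt (Matrix.of F) x‖ := by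
    by_contra! h
    exact absurd (hFm.norm_le h1 h1' (hε.le.trans hεΔ.le) h) hd0.not_ge
  obtain ⟨a, a', ha, ha', haa'⟩ := Matrix.exists_lt_norm_inner (hε.le.trans hεΔ.le) hx
  rw [← sesquilinear_apply] at haa'
  set f := sesquilinear (Matrix.of F) a a' with hf
  set w := ∑ i, a i • t i with hw
  set w' := ∑ i, a' i • t i with hw'
  have hwn : ‖w‖ ≤ 1 := norm_sum_smul_le_one h1 h1' hπ hPm ha
  have hwn' : ‖w'‖ ≤ 1 := norm_sum_smul_le_one h1 h1' hπ hPm ha'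
  have hwd : ∀ a : EuclideanSpace ℂ κ, HasDegree ρ m (∑ i, a i • t i) := fun a =>
    HasDegree.sum fun i _ => (ht i).hasDegree.smul (a i)
  obtain ⟨h, hhx, hhn, hh⟩ := exists_bump_mul_pullback_eq_zero (hα x) d.support
  have hπh : ‖ρ.π h‖ ≤ 1 := (NonUnitalStarAlgHom.norm_apply_le ρ.π h).trans hhn
  set T : B → B := fun y => ρ.π h * (star w * y * w') * ρ.π h with hT
  have hTsub : ∀ y y', T y - T y' = T (y - y') := fun y y' => by
    simp only [hT, mul_sub, sub_mul]
  have hTn : ∀ y, ‖T y‖ ≤ ‖y‖ := fun y => by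
    have e1 : ‖star w * y * w'‖ ≤ ‖y‖ := by
      calc ‖star w * y * w'‖ ≤ ‖star w‖ * ‖y‖ * ‖w'‖ :=
            (norm_mul_le _ _).trans (by gcongr; exact norm_mul_le _ _)
        _ ≤ 1 * ‖y‖ * 1 := by rw [norm_star]; gcongr
        _ = ‖y‖ := by ring
    calc ‖T y‖ ≤ ‖ρ.π h‖ * ‖star w * y * w'‖ * ‖ρ.π h‖ :=
          (norm_mul_le _ _).trans (by gcongr; exact norm_mul_le _ _)
      _ ≤ 1 * ‖y‖ * 1 := by gcongr
      _ = ‖y‖ := by ring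
  have hT0 : T (d.sum fun _ y => y) = ρ.π (h * f * h) := by
    have e1 : ∀ k ∈ d.support, k ≠ 0 → T (d k) = 0 := fun k hk hk0 => by
      have e2 : HasDegree ρ (-m + k + m) (star w * d k * w') :=
        ((hwd a).star.mul (hdeg k)).mul (hwd a')
      simp only [hT]
      rw [e2 h, mul_assoc, ← map_mul]
      have e3 : -(m : ℤ) + k + m = k := by ring
      rw [e3, hh k hk hk0, map_zero, mul_zero]
    have e2 : T (d 0) = ρ.π (h * f * h) := by
      simp only [hT]
      rw [hFm.sesquilinear a a', map_mul, map_mul]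
    have e3 : T (d.sum fun _ y => y) = ∑ k ∈ d.support, T (d k) := by
      simp only [hT, Finsupp.sum, Finset.mul_sum, Finset.sum_mul]
    rw [e3, Finset.sum_eq_single 0 e1, e2]
    intro h0
    rw [Finsupp.notMem_support_iff.1 h0]
    simp [hT]
  have hTI : T (star b * b) ∈ I :=
    I.mul_mem_right _ _ (I.mul_mem_left _ _ (I.mul_mem_right _ _ (I.mul_mem_left _ _
      (I.mul_mem_left _ _ hbI))))
  refine ⟨x, exists_π_mem_of_norm_sub_lt ρ.π hI hTI (f := h * f * h) ?_⟩
  rw [← hT0, hTsub]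
  refine ((hTn _).trans_lt hcc').trans (hεΔ.trans (haa'.trans_eq ?_))
  simp [hhx]

/-- Functions in a closed ideal form a closed ideal of `C(X)` with invariant zero set, so by
minimality there are no such functions besides zero, or all functions belong to the ideal. -/
theorem π_one_mem_of_isMinimal {ι : Type u} [Fintype ι] {s : ι → V.Section}
    (hs : IsParsevalFrame s) (hV : ∀ x, Nontrivial (V.Fiber x)) (hα : IsMinimalHomeomorph α)
    {I : TwoSidedIdeal B} (hI : IsClosed (I : Set B)) {x₀ : X} {g : C(X, ℂ)} (hg : g x₀ ≠ 0)
    (hgI : ρ.π g ∈ I) : ρ.π 1 ∈ I := by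
  let J : Ideal C(X, ℂ) :=
    { carrier := {f | ρ.π f ∈ I}
      add_mem' := fun {f f'} h h' => by
        change ρ.π (f + f') ∈ I
        rw [map_add]
        exact I.add_mem h h'
      zero_mem' := by
        change ρ.π 0 ∈ I
        rw [map_zero]
        exact I.zero_mem
      smul_mem' := fun f f' h => by
        change ρ.π (f * f') ∈ I
        rw [map_mul]
        exact I.mul_mem_left _ _ h }
  have hJc : IsClosed (J : Set C(X, ℂ)) := by
    have hc : Continuous ρ.π := AddMonoidHomClass.continuous_of_bound ρ.π 1 fun f => by
      simpa using NonUnitalStarAlgHom.norm_apply_le ρ.π f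
    exact hI.preimage hc
  let F : Set X := (ContinuousMap.setOfIdeal J)ᶜ
  have hF : ∀ x, x ∈ F ↔ ∀ f ∈ J, f x = 0 := fun x => by
    simp only [F, Set.mem_compl_iff, ContinuousMap.mem_setOfIdeal]
    push Not
    rfl
  have hFα : α '' F ⊆ F := by
    rintro _ ⟨x, hx, rfl⟩
    refine (hF _).2 fun f hf => ?_
    obtain ⟨i, hi⟩ := hs.exists_ne_zero x
    have h1 : ⟪s i, (V.sectionCorrespondence α).φ f (s i)⟫_(C(X, ℂ)) ∈ J := by
      change ρ.π _ ∈ I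
      rw [ρ.map_inner, ← ρ.map_left]
      exact I.mul_mem_left _ _ (I.mul_mem_right _ _ hf)
    have h2 := (hF x).1 hx _ h1
    rw [Section.inner_apply, sectionCorrespondence_φ_apply, inner_smul_right, mul_eq_zero] at h2
    exact h2.resolve_right (inner_self_ne_zero.2 hi)
  have hFe : F = ∅ := by
    refine (hα F (ContinuousMap.setOfIdeal_open J).isClosed_compl hFα).resolve_right fun h => ?_
    exact hg ((hF x₀).1 (h ▸ Set.mem_univ x₀) g hgI)
  have h1 : (1 : C(X, ℂ)) ∈ J := by
    rw [← ContinuousMap.idealOfSet_ofIdeal_isClosed hJc, ContinuousMap.mem_idealOfSet]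
    intro x hx
    exact absurd (hFe ▸ hx : x ∈ (∅ : Set X)) (Set.notMem_empty x)
  exact h1

end HermitianVectorBundle

/-! ### The universal covariant representation -/

namespace CStarCorrespondence

variable {A : Type u} {E : Type v} [CommCStarAlgebra A] [PartialOrder A] [StarOrderedRing A]
  [NormedAddCommGroup E] [NormedSpace ℂ E] [CompleteSpace E] [Module A E] [CStarModule A E]

/-- The representation `(π, zτ)` for a complex number `z` of modulus one. -/
def Representation.twist {C : CStarCorrespondence A E} {B : Type*} [NonUnitalCStarAlgebra B]
    (ρ : C.Representation B) (z : Circle) : C.Representation B where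
  π := ρ.π
  τ := (z : ℂ) • ρ.τ
  map_inner ξ η := by
    rw [ρ.map_inner, LinearMap.smul_apply, LinearMap.smul_apply, star_smul, smul_mul_smul_comm,
      RCLike.star_def, ← Circle.coe_inv_eq_conj, ← Circle.coe_mul, inv_mul_cancel, Circle.coe_one,
      one_smul]
  map_left a ξ := by
    rw [LinearMap.smul_apply, LinearMap.smul_apply, mul_smul_comm, ρ.map_left]

theorem Representation.IsCovariant.twist {C : CStarCorrespondence A E} {B : Type*}
    [NonUnitalCStarAlgebra B] {ρ : C.Representation B} (h : ρ.IsCovariant) (z : Circle) :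
    (ρ.twist z).IsCovariant := by
  obtain ⟨ψ, h1, h2⟩ := h
  refine ⟨ψ, fun ξ η => ?_, h2⟩
  rw [h1]
  change _ = ((z : ℂ) • ρ.τ ξ) * star ((z : ℂ) • ρ.τ η)
  rw [star_smul, smul_mul_smul_comm, RCLike.star_def, ← Circle.coe_inv_eq_conj, ← Circle.coe_mul,
    mul_inv_cancel, Circle.coe_one, one_smul]

variable (C : CStarCorrespondence A E)

/-- The circle acts on the covariant representations. -/
def CovariantRep.twist {C : CStarCorrespondence A E} (ρ : C.CovariantRep) (z : Circle) :
    C.CovariantRep :=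
  ⟨ρ.B, ρ.rep.twist z, ρ.covariant.twist z⟩

/-- The universal covariant representation, in the Cuntz–Pimsner algebra. -/
def univRep : C.Representation C.CuntzPimsner where
  π :=
    { toFun := fun a => ⟨C.univπ a, subset_closure
        (NonUnitalStarAlgebra.subset_adjoin ℂ _ (Or.inl ⟨a, rfl⟩))⟩
      map_smul' := fun c a => by ext ρ; exact map_smul ρ.rep.π c a
      map_zero' := by ext ρ; exact map_zero ρ.rep.π
      map_add' := fun a a' => by ext ρ; exact map_add ρ.rep.π a a'
      map_mul' := fun a a' => by ext ρ; exact map_mul ρ.rep.π a a'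
      map_star' := fun a => by ext ρ; exact map_star ρ.rep.π a }
  τ :=
    { toFun := fun ξ => ⟨C.univτ ξ, subset_closure
        (NonUnitalStarAlgebra.subset_adjoin ℂ _ (Or.inr ⟨ξ, rfl⟩))⟩
      map_add' := fun ξ η => by ext ρ; exact map_add ρ.rep.τ ξ η
      map_smul' := fun c ξ => by ext ρ; exact map_smul ρ.rep.τ c ξ }
  map_inner ξ η := by ext ρ; exact ρ.rep.map_inner ξ η
  map_left a ξ := by ext ρ; exact ρ.rep.map_left a ξ

/-- The component of an element of the Cuntz–Pimsner algebra at a covariant representation. -/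
def component (ρ : C.CovariantRep) : C.CuntzPimsner →⋆ₙₐ[ℂ] ρ.B where
  toFun y := (y : C.RepProduct) ρ
  map_smul' _ _ := rfl
  map_zero' := rfl
  map_add' _ _ := rfl
  map_mul' _ _ := rfl
  map_star' _ := rfl

/-- The gauge action on the product of all covariant representations permutes the factors. -/
def repProductGauge (z : Circle) : C.RepProduct →⋆ₙₐ[ℂ] C.RepProduct where
  toFun y := ⟨fun ρ => y (ρ.twist z), memℓp_infty (by
    obtain ⟨K, hK⟩ := (lp.memℓp y).bddAbove
    refine ⟨K, ?_⟩
    rintro _ ⟨ρ, rfl⟩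
    exact hK ⟨ρ.twist z, rfl⟩)⟩
  map_smul' _ _ := rfl
  map_zero' := rfl
  map_add' _ _ := rfl
  map_mul' _ _ := rfl
  map_star' _ := rfl

theorem repProductGauge_mem (z : Circle) {y : C.RepProduct} (hy : y ∈ C.cuntzPimsnerSubalgebra) :
    C.repProductGauge z y ∈ C.cuntzPimsnerSubalgebra := by
  have hc : Continuous (C.repProductGauge z) :=
    AddMonoidHomClass.continuous_of_bound _ 1 fun f => by
      simpa using NonUnitalStarAlgHom.norm_apply_le (C.repProductGauge z) f
  refine map_mem_closure hc hy fun y hy => ?_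
  refine NonUnitalStarAlgebra.adjoin_induction ℂ (p := fun y _ => C.repProductGauge z y ∈
    NonUnitalStarAlgebra.adjoin ℂ (Set.range C.univπ ∪ Set.range C.univτ)) ?_
    (fun _ _ _ _ h h' => ?_) ?_ (fun _ _ _ _ h h' => ?_) (fun c _ _ h => ?_) (fun _ _ h => ?_) hy
  · rintro _ (⟨a, rfl⟩ | ⟨ξ, rfl⟩)
    · exact NonUnitalStarAlgebra.subset_adjoin ℂ _ (Or.inl ⟨a, rfl⟩)
    · have h : C.repProductGauge z (C.univτ ξ) = (z : ℂ) • C.univτ ξ := rfl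
      rw [h]
      exact SMulMemClass.smul_mem _ (NonUnitalStarAlgebra.subset_adjoin ℂ _ (Or.inr ⟨ξ, rfl⟩))
  · rw [map_add]; exact add_mem h h'
  · rw [map_zero]; exact zero_mem _
  · rw [map_mul]; exact mul_mem h h'
  · rw [map_smul]; exact SMulMemClass.smul_mem c h
  · rw [map_star]; exact star_mem h

/-- The gauge action `τ(ξ) ↦ z τ(ξ)` on the Cuntz–Pimsner algebra. -/
def gauge (z : Circle) : C.CuntzPimsner →⋆ₙₐ[ℂ] C.CuntzPimsner where
  toFun y := ⟨C.repProductGauge z y, C.repProductGauge_mem z y.2⟩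
  map_smul' _ _ := rfl
  map_zero' := rfl
  map_add' _ _ := rfl
  map_mul' _ _ := rfl
  map_star' _ := rfl

theorem dense_adjoin_univRep :
    Dense (NonUnitalStarAlgebra.adjoin ℂ (Set.range C.univRep.π ∪ Set.range C.univRep.τ) :
      Set C.CuntzPimsner) := by
  intro y
  rw [Topology.IsInducing.subtypeVal.closure_eq_preimage_closure_image]
  refine closure_mono ?_ y.2
  intro w hw
  refine NonUnitalStarAlgebra.adjoin_induction ℂ (p := fun w _ => w ∈ Subtype.val ''
    (NonUnitalStarAlgebra.adjoin ℂ (Set.range C.univRep.π ∪ Set.range C.univRep.τ) :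
      Set C.CuntzPimsner)) ?_ ?_ ?_ ?_ ?_ ?_ hw
  · rintro _ (⟨a, rfl⟩ | ⟨ξ, rfl⟩)
    · exact ⟨C.univRep.π a, NonUnitalStarAlgebra.subset_adjoin ℂ _ (Or.inl ⟨a, rfl⟩), rfl⟩
    · exact ⟨C.univRep.τ ξ, NonUnitalStarAlgebra.subset_adjoin ℂ _ (Or.inr ⟨ξ, rfl⟩), rfl⟩
  · rintro _ _ _ _ ⟨y, hy, rfl⟩ ⟨y', hy', rfl⟩
    exact ⟨y + y', add_mem hy hy', rfl⟩
  · exact ⟨0, zero_mem _, rfl⟩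
  · rintro _ _ _ _ ⟨y, hy, rfl⟩ ⟨y', hy', rfl⟩
    exact ⟨y * y', mul_mem hy hy', rfl⟩
  · rintro c _ _ ⟨y, hy, rfl⟩
    exact ⟨c • y, SMulMemClass.smul_mem c hy, rfl⟩
  · rintro _ _ ⟨y, hy, rfl⟩
    exact ⟨star y, star_mem hy, rfl⟩

end CStarCorrespondence

namespace HermitianVectorBundle

variable {X : Type u} [TopologicalSpace X] [CompactSpace X] [T2Space X]

section Univ

variable {V : HermitianVectorBundle.{u, v} X} {α : X ≃ₜ X} {ι : Type u} [Fintype ι]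
  {s : ι → V.Section} (hs : IsParsevalFrame s) (hV : ∀ x, Nontrivial (V.Fiber x))
include hs hV

theorem sum_univRep_τ : ∑ i, (V.sectionCorrespondence α).univRep.τ (s i) *
    star ((V.sectionCorrespondence α).univRep.τ (s i)) =
      (V.sectionCorrespondence α).univRep.π 1 := by
  ext1
  ext1
  funext ρ
  have h := (hs.isCovariant_iff hV ρ.rep).1 ρ.covariant
  have h2 := map_sum ((V.sectionCorrespondence α).component ρ)
    (fun i => (V.sectionCorrespondence α).univRep.τ (s i) *
      star ((V.sectionCorrespondence α).univRep.τ (s i))) Finset.univ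
  exact h2.trans h

theorem univRep_π_injective : Function.Injective (V.sectionCorrespondence α).univRep.π := by
  obtain ⟨ρ, hρ⟩ := V.exists_covariantRep hV α hs Set.univ (fun x => by simp)
  refine (injective_iff_map_eq_zero _).2 fun f hf => ?_
  have h : ρ.rep.π f = 0 := by
    change (V.sectionCorrespondence α).component ρ ((V.sectionCorrespondence α).univRep.π f) = 0
    rw [hf, map_zero]
  ext x
  exact (hρ f).1 h x trivial

end Univ

/-- Inside a forward invariant closed nonempty set there is an invariant nonempty set, the
intersection of its forward images. -/
theorem exists_invariant_subset (α : X ≃ₜ X) {E : Set X} (hE : IsClosed E) (hαE : α '' E ⊆ E)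
    (hne : E.Nonempty) : ∃ Y ⊆ E, Y.Nonempty ∧ ∀ x, α x ∈ Y ↔ x ∈ Y := by
  let S : ℕ → Set X := fun n => (fun T => α '' T)^[n] E
  have hS : ∀ n, S (n + 1) = α '' S n := fun n => Function.iterate_succ_apply' _ _ _
  have hanti : ∀ n, S (n + 1) ⊆ S n := fun n => by
    induction n with
    | zero => exact hαE
    | succ n ih =>
      rw [hS (n + 1)]
      conv_rhs => rw [hS n]
      exact Set.image_mono ih
  have hcl : ∀ n, IsClosed (S n) := fun n => by
    induction n with
    | zero => exact hE
    | succ n ih => rw [hS]; exact α.isClosedMap _ ih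
  have hnon : ∀ n, (S n).Nonempty := fun n => by
    induction n with
    | zero => exact hne
    | succ n ih => rw [hS]; exact ih.image _
  refine ⟨⋂ n, S n, Set.iInter_subset S 0,
    IsCompact.nonempty_iInter_of_sequence_nonempty_isCompact_isClosed S hanti hnon
      (hcl 0).isCompact hcl, fun x => ?_⟩
  simp only [Set.mem_iInter]
  constructor
  · intro h n
    have h1 := h (n + 1)
    rw [hS] at h1
    exact (α.injective.mem_set_image).1 h1
  · intro h n
    refine hanti n ?_
    rw [hS]
    exact Set.mem_image_of_mem α (h n)

end HermitianVectorBundle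

end

theorem mainTheorem1 {X : Type u} [MetricSpace X] [CompactSpace X] [Infinite X]
    (V : HermitianVectorBundle.{u, v} X) (hV : ∀ x, Nontrivial (V.Fiber x)) (α : X ≃ₜ X) :
    IsSimpleCStarAlgebra (V.sectionCorrespondence α).CuntzPimsner ↔ IsMinimalHomeomorph α := by
  obtain ⟨ι, _, s, hs⟩ := V.exists_parseval_frame
  set C := V.sectionCorrespondence α
  have hinj : Function.Injective C.univRep.π := HermitianVectorBundle.univRep_π_injective hs hV
  constructor
  · rintro ⟨-, hsimple⟩ E hE hαE
    by_contra! h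
    obtain ⟨hne, hE'⟩ := h
    -- the kernel of a representation supported in `E` is a nontrivial ideal
    obtain ⟨Y, hYE, ⟨x, hx⟩, hY⟩ := HermitianVectorBundle.exists_invariant_subset α hE hαE hne
    obtain ⟨ρ, hρ⟩ := V.exists_covariantRep hV α hs Y hY
    have hcomp : Continuous (C.component ρ) :=
      AddMonoidHomClass.continuous_of_bound _ 1 fun f => by
        simpa using NonUnitalStarAlgHom.norm_apply_le (C.component ρ) f
    have hker : ∀ f, C.univRep.π f ∈ TwoSidedIdeal.ker (C.component ρ) ↔ ∀ x ∈ Y, f x = 0 :=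
      fun f => by
        rw [TwoSidedIdeal.mem_ker]
        exact hρ f
    have hclosed : IsClosed (TwoSidedIdeal.ker (C.component ρ) : Set C.CuntzPimsner) := by
      have h : (TwoSidedIdeal.ker (C.component ρ) : Set C.CuntzPimsner) =
          C.component ρ ⁻¹' {0} := by
        ext y
        exact TwoSidedIdeal.mem_ker _
      rw [h]
      exact isClosed_singleton.preimage hcomp
    rcases hsimple _ hclosed with h | h
    · obtain ⟨x', hx'⟩ := (Set.ne_univ_iff_exists_notMem E).1 hE'
      let f : C(X, ℂ) := ⟨fun y => ((Metric.infDist y E : ℝ) : ℂ), by fun_prop⟩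
      have h1 : C.univRep.π f = 0 := by
        have h2 := (hker f).2 fun y hy => by
          change ((Metric.infDist y E : ℝ) : ℂ) = 0
          rw [Metric.infDist_zero_of_mem (hYE hy), Complex.ofReal_zero]
        rw [h] at h2
        simpa using h2
      have h3 : ((Metric.infDist x' E : ℝ) : ℂ) = 0 :=
        DFunLike.congr_fun ((map_eq_zero_iff _ hinj).1 h1) x'
      rw [Complex.ofReal_eq_zero] at h3
      exact hx' ((hE.mem_iff_infDist_zero hne).2 h3)
    · have h1 : C.univRep.π 1 ∈ TwoSidedIdeal.ker (C.component ρ) := by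
        rw [h]
        trivial
      exact one_ne_zero ((hker 1).1 h1 x hx)
  · intro hα
    have hsum := HermitianVectorBundle.sum_univRep_τ (α := α) hs hV
    have hd : Dense (Submodule.span ℂ (HermitianVectorBundle.monomials C.univRep) :
        Set C.CuntzPimsner) :=
      C.dense_adjoin_univRep.mono HermitianVectorBundle.adjoin_subset_span_monomials
    refine ⟨⟨C.univRep.π 1, 0, fun h => ?_⟩, fun I hI => ?_⟩
    · exact one_ne_zero ((map_eq_zero_iff _ hinj).1 h)
    rw [or_iff_not_imp_left]
    intro hI0
    obtain ⟨b, hbI, hb⟩ : ∃ b ∈ I, b ≠ 0 := by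
      by_contra! h
      exact hI0 (eq_bot_iff.2 fun y hy => by simpa using h y hy)
    obtain ⟨x, g, hg, hgI⟩ := HermitianVectorBundle.exists_π_mem_of_ne_zero hsum hinj hd C.gauge
      (fun z f => rfl) (fun z ξ => rfl)
      (fun x k hk => HermitianVectorBundle.zpow_apply_ne_of_isMinimal hα hk x) hI hbI hb
    have h1 := HermitianVectorBundle.π_one_mem_of_isMinimal hs hV hα hI hg hgI
    refine eq_top_iff.2 fun y _ => ?_
    rw [← HermitianVectorBundle.π_one_mul hd y]
    exact I.mul_mem_right _ _ h1
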